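/- Let $G$ be a finite group and $\mathbb{K}$ a field of characteristic zero. For a subgroup $H\le G$ let $R(H)=R_{\mathbb{K}}(H)$ be the ring of virtual characters of $H$ over $\mathbb{K}$, with its $\lambda$-ring structure given by exterior powers of representations. Let $I_H\subset R(H)$ be the ideal of virtual characters of degree $0$, let $\gamma^n(x)=\lambda^n(x+n-1)$, and let $\Gamma^n(H)$ be the additive subgroup of $R(H)$ generated by the monomials $\gamma^{n_1}(x_1)\cdots\gamma^{n_k}(x_k)$ with $x_i\in I_H$ and $n_1+\dots+n_k\ge n$. Give $R(H)$ the topology in which the subgroups $\Gamma^n(H)$, $n\ge 0$, form a basis of neighbourhoods of $0$, and let $\widehat{R}(H)$ be its completion. Then for every subgroup $H\le G$ the induction of characters $\mathrm{ind}_H^G: R(H)\to R(G)$ is continuous, so that it extends uniquely to a continuous additive map $\widehat{\mathrm{ind}_H^G}:\widehat{R}(H)\to\widehat{R}(G)$. Moreover, let $X$ be a family of subgroups of $G$ that contains a $p$-Sylow subgroup of $G$ for each prime $p$. Then the map $$\widehat{\mathrm{ind}}:\ \bigoplus_{H\in X}\widehat{R}(H)\longrightarrow\widehat{R}(G)$$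 defined on each summand $\widehat{R}(H)$ by $\widehat{\mathrm{ind}_H^G}$ is surjective. -/

import Mathlib

noncomputable section

namespace VirtualCharacter

universe u v w

/-! ### Characters of finite-dimensional representations -/

/-- `χ : G → K` is the character of a finite-dimensional representation of `G` over `K`.
Up to isomorphism, the space of the representation is some `Kⁿ`; see `isCharacter_character`. -/
def IsCharacter {K : Type u} {G : Type v} [Field K] [Group G] (χ : G → K) : Prop :=
  ∃ (n : ℕ) (ρ : Representation K G (Fin n → K)), ρ.character = χ

section

variable {K : Type u} {G : Type v} [Field K] [Group G]

/-- The character of any finite-dimensional representation, on a space in any universe,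
is a character in the sense of `IsCharacter`. -/
theorem isCharacter_character {V : Type w} [AddCommGroup V] [Module K V] [FiniteDimensional K V]
    (ρ : Representation K G V) : IsCharacter ρ.character := by
  let e : V ≃ₗ[K] (Fin (Module.finrank K V) → K) := (Module.finBasis K V).equivFun
  refine ⟨Module.finrank K V,
    { toFun := fun g => e.conj (ρ g)
      map_one' := by ext; simp [LinearEquiv.conj_apply]
      map_mul' := fun g h => by
        rw [map_mul, Module.End.mul_eq_comp, LinearEquiv.conj_comp]; rfl }, ?_⟩
  funext g
  exact LinearMap.trace_conj' (ρ g) e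

theorem IsCharacter.add {χ ψ : G → K} (hχ : IsCharacter χ) (hψ : IsCharacter ψ) :
    IsCharacter (χ + ψ) := by
  obtain ⟨m, ρ, rfl⟩ := hχ
  obtain ⟨n, σ, rfl⟩ := hψ
  have h : (ρ.prod σ).character = ρ.character + σ.character := by
    funext g
    exact LinearMap.trace_prodMap' (ρ g) (σ g)
  exact h ▸ isCharacter_character (ρ.prod σ)

theorem IsCharacter.mul {χ ψ : G → K} (hχ : IsCharacter χ) (hψ : IsCharacter ψ) :
    IsCharacter (χ * ψ) := by
  obtain ⟨m, ρ, rfl⟩ := hχ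
  obtain ⟨n, σ, rfl⟩ := hψ
  exact Representation.char_tensor ρ σ ▸ isCharacter_character (ρ.tprod σ)

theorem IsCharacter.one : IsCharacter (1 : G → K) := by
  have h : (Representation.trivial K G K).character = 1 := by
    funext g
    simp [Representation.character, Representation.trivial]
  exact h ▸ isCharacter_character (Representation.trivial K G K)

theorem IsCharacter.zero : IsCharacter (0 : G → K) := by
  have h : (Representation.trivial K G (Fin 0 → K)).character = 0 := by
    funext g
    simp [Representation.character, Representation.trivial]
  exact h ▸ isCharacter_character (Representation.trivial K G (Fin 0 → K))

end

/-! ### The ring of virtual characters -/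

section

variable (K : Type u) (G : Type v) [Field K] [Group G]

/-- The virtual characters of `G` over `K` (differences of characters), as a subring of the
ring of functions `G → K`: sums and products correspond to direct sums and tensor products. -/
def virtualCharacters : Subring (G → K) where
  carrier := {f | ∃ χ ψ : G → K, IsCharacter χ ∧ IsCharacter ψ ∧ f = χ - ψ}
  zero_mem' := ⟨0, 0, .zero, .zero, by simp⟩
  one_mem' := ⟨1, 0, .one, .zero, by simp⟩
  add_mem' := by
    rintro _ _ ⟨a, b, ha, hb, rfl⟩ ⟨c, d, hc, hd, rfl⟩
    exact ⟨a + c, b + d, ha.add hc, hb.add hd, by ring⟩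
  neg_mem' := by
    rintro _ ⟨a, b, ha, hb, rfl⟩
    exact ⟨b, a, hb, ha, by ring⟩
  mul_mem' := by
    rintro _ _ ⟨a, b, ha, hb, rfl⟩ ⟨c, d, hc, hd, rfl⟩
    exact ⟨a * c + b * d, a * d + b * c, (ha.mul hc).add (hb.mul hd),
      (ha.mul hd).add (hb.mul hc), by ring⟩

/-- The character ring `R_K(G)`. -/
def CharRing : Type (max u v) := virtualCharacters K G

instance : CommRing (CharRing K G) := inferInstanceAs (CommRing (virtualCharacters K G))

/-- The degree of a virtual character, that is, its value at `1`: the degree of `[V] - [W]` is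
the integer `dim V - dim W`, considered as an element of `K`. -/
def augmentation : CharRing K G →+* K :=
  (Pi.evalRingHom (fun _ : G => K) 1).comp (virtualCharacters K G).subtype

end

section

variable {K : Type u} {G : Type v} [Field K] [Group G]

/-- The class `[ρ]` in `R_K(G)` of a finite-dimensional representation. -/
def ofRep {V : Type w} [AddCommGroup V] [Module K V] [FiniteDimensional K V]
    (ρ : Representation K G V) : CharRing K G :=
  ⟨ρ.character, ρ.character, 0, isCharacter_character ρ, .zero, by simp⟩

theorem exists_eq_ofRep_sub_ofRep (x : CharRing K G) :
    ∃ (m n : ℕ) (ρ : Representation K G (Fin m → K)) (σ : Representation K G (Fin n → K)),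
      x = ofRep ρ - ofRep σ := by
  obtain ⟨f, _, _, ⟨m, ρ, rfl⟩, ⟨n, σ, rfl⟩, hf⟩ := x
  exact ⟨m, n, ρ, σ, Subtype.ext hf⟩

theorem exists_int_augmentation (x : CharRing K G) :
    ∃ n : ℤ, augmentation K G x = n := by
  obtain ⟨m, n, ρ, σ, rfl⟩ := exists_eq_ofRep_sub_ofRep x
  refine ⟨m - n, ?_⟩
  rw [map_sub]
  change ρ.character 1 - σ.character 1 = _
  simp

/-! ### Exterior powers, lambda and gamma operations -/

/-- The `n`-th exterior power of a representation. -/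
def extPower {V : Type w} [AddCommGroup V] [Module K V] (ρ : Representation K G V) (n : ℕ) :
    Representation K G (⋀[K]^n V) where
  toFun g := exteriorPower.map n (ρ g)
  map_one' := by
    rw [map_one]; exact exteriorPower.map_id
  map_mul' g h := by
    rw [map_mul]; exact exteriorPower.map_comp (ρ h) (ρ g)

/-- The power series `λ_t[ρ] = ∑ₙ [Λⁿ ρ] tⁿ` over `R_K(G)`. -/
def lambdaSeries {V : Type w} [AddCommGroup V] [Module K V] [FiniteDimensional K V]
    (ρ : Representation K G V) : PowerSeries (CharRing K G) :=
  PowerSeries.mk fun n => ofRep (extPower ρ n)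

theorem ofRep_extPower_zero {V : Type w} [AddCommGroup V] [Module K V] [FiniteDimensional K V]
    (ρ : Representation K G V) : ofRep (extPower ρ 0) = 1 := by
  refine Subtype.ext (funext fun g => ?_)
  change LinearMap.trace K _ (exteriorPower.map 0 (ρ g)) = 1
  have h : exteriorPower.map 0 (ρ g) = LinearMap.id := by
    refine LinearMap.ext fun x => (exteriorPower.zeroEquiv K V).injective ?_
    exact LinearMap.congr_fun (exteriorPower.zeroEquiv_naturality (ρ g)) x
  rw [h, LinearMap.trace_id, LinearEquiv.finrank_eq (exteriorPower.zeroEquiv K V)]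
  simp

theorem ofRep_extPower_one {V : Type w} [AddCommGroup V] [Module K V] [FiniteDimensional K V]
    (ρ : Representation K G V) : ofRep (extPower ρ 1) = ofRep ρ := by
  refine Subtype.ext (funext fun g => ?_)
  change LinearMap.trace K _ (exteriorPower.map 1 (ρ g)) = LinearMap.trace K _ (ρ g)
  rw [← LinearMap.trace_conj' _ (exteriorPower.oneEquiv K V)]
  congr 1
  refine LinearMap.ext fun x => ?_
  have h := LinearMap.congr_fun (exteriorPower.oneEquiv_naturality (ρ g))
    ((exteriorPower.oneEquiv K V).symm x)
  simpa [LinearEquiv.conj_apply] using h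

/-- The `n`-th lambda operation on `R_K(G)`: `λ_t([ρ] - [σ]) = λ_t[ρ] / λ_t[σ]`, where `λ_t[σ]`
has constant coefficient `1`. As `λ_t` turns direct sums into products, the quotient
does not depend on how the virtual character is written as `[ρ] - [σ]`. -/
def lambdaOp (n : ℕ) (x : CharRing K G) : CharRing K G :=
  let h := exists_eq_ofRep_sub_ofRep x
  let ρ := h.choose_spec.choose_spec.choose
  let σ := h.choose_spec.choose_spec.choose_spec.choose
  PowerSeries.coeff n (lambdaSeries ρ * PowerSeries.invOfUnit (lambdaSeries σ) 1)

theorem lambdaOp_one (x : CharRing K G) : lambdaOp 1 x = x := by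
  have key : ∀ {A B : PowerSeries (CharRing K G)}, PowerSeries.coeff 0 A = 1 →
      PowerSeries.coeff 0 B = 1 → PowerSeries.coeff 1 (A * PowerSeries.invOfUnit B 1) =
        PowerSeries.coeff 1 A - PowerSeries.coeff 1 B := by
    intro A B hA hB
    have hB' : PowerSeries.constantCoeff B = ((1 : (CharRing K G)ˣ) : CharRing K G) := by
      simpa using hB
    have h0 : PowerSeries.coeff 0 (PowerSeries.invOfUnit B 1) = 1 := by simp
    have h1 := congrArg (PowerSeries.coeff 1) (PowerSeries.mul_invOfUnit B 1 hB')
    rw [PowerSeries.coeff_mul] at h1 ⊢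
    simp only [Finset.Nat.antidiagonal_succ, Finset.Nat.antidiagonal_zero, Finset.sum_cons,
      Finset.map_singleton, Finset.sum_singleton, Function.Embedding.prodMap, Function.Embedding.coeFn_mk,
      Prod.map, Nat.succ_eq_add_one, zero_add, Function.Embedding.refl_apply, hA, hB, h0,
      PowerSeries.coeff_one] at h1 ⊢
    simp only [one_ne_zero, if_false] at h1
    linear_combination h1
  have h := exists_eq_ofRep_sub_ofRep x
  conv_rhs => rw [h.choose_spec.choose_spec.choose_spec.choose_spec]
  rw [lambdaOp, key]
  · simp only [lambdaSeries, PowerSeries.coeff_mk, ofRep_extPower_one]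
  · simp only [lambdaSeries, PowerSeries.coeff_mk, ofRep_extPower_zero]
  · simp only [lambdaSeries, PowerSeries.coeff_mk, ofRep_extPower_zero]

/-- The `n`-th gamma operation `γⁿ(x) = λⁿ(x + n - 1)`. -/
def gammaOp (n : ℕ) (x : CharRing K G) : CharRing K G :=
  lambdaOp n (x + (n : CharRing K G) - 1)

theorem gammaOp_one (x : CharRing K G) : gammaOp 1 x = x := by
  rw [gammaOp, lambdaOp_one]; simp

end

/-! ### Induction -/

section

variable {K : Type u} {G : Type v} [Field K] [Group G]

open Classical in
/-- Frobenius' formula for the function on `G` induced from a function `f` on `H`. -/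
def indFun [Fintype G] (H : Subgroup G) (f : H → K) (g : G) : K :=
  (Nat.card H : K)⁻¹ * ∑ x : G, if h : x * g * x⁻¹ ∈ H then f ⟨x * g * x⁻¹, h⟩ else 0

theorem indFun_zero [Fintype G] (H : Subgroup G) : indFun H (0 : H → K) = 0 := by
  funext g
  simp [indFun]

theorem indFun_add [Fintype G] (H : Subgroup G) (f₁ f₂ : H → K) :
    indFun H (f₁ + f₂) = indFun H f₁ + indFun H f₂ := by
  funext g
  simp only [indFun, Pi.add_apply, ← mul_add, ← Finset.sum_add_distrib]
  congr 1
  refine Finset.sum_congr rfl fun x _ => ?_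
  split_ifs <;> simp

theorem indFun_sub [Fintype G] (H : Subgroup G) (f₁ f₂ : H → K) :
    indFun H (f₁ - f₂) = indFun H f₁ - indFun H f₂ := by
  rw [eq_sub_iff_add_eq, ← indFun_add, sub_add_cancel]

theorem trace_pi_eq_sum {ι V : Type*} [Fintype ι] [AddCommGroup V] [Module K V]
    [FiniteDimensional K V] [DecidableEq ι] (T : (ι → V) →ₗ[K] (ι → V)) :
    LinearMap.trace K _ T =
      ∑ i, LinearMap.trace K V (LinearMap.proj i ∘ₗ T ∘ₗ LinearMap.single K (fun _ => V) i) := by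
  have h : T = ∑ i, (T ∘ₗ LinearMap.single K (fun _ => V) i) ∘ₗ LinearMap.proj i := by
    refine LinearMap.ext fun f => ?_
    simp only [LinearMap.sum_apply, LinearMap.comp_apply, LinearMap.proj_apply,
      LinearMap.single_apply, ← map_sum, Finset.univ_sum_single]
  conv_lhs => rw [h]
  rw [map_sum]
  refine Finset.sum_congr rfl fun i _ => ?_
  rw [LinearMap.trace_comp_comm']

theorem character_coind [Fintype G] [CharZero K] (H : Subgroup G) {V : Type w} [AddCommGroup V]
    [Module K V] [FiniteDimensional K V] (ρ : Representation K H V) :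
    (Representation.coind H.subtype ρ).character = indFun H ρ.character := by
  classical
  have hcard : (Nat.card H : K) ≠ 0 := Nat.cast_ne_zero.2 Nat.card_pos.ne'
  have : Fintype H := Fintype.ofFinite H
  funext g
  let T : (G → V) →ₗ[K] (G → V) := LinearMap.pi fun x =>
    (Nat.card H : K)⁻¹ • ∑ h : H, ρ h⁻¹ ∘ₗ LinearMap.proj ((h : G) * x * g)
  have hT : ∀ f x, T f x = (Nat.card H : K)⁻¹ • ∑ h : H, ρ h⁻¹ (f ((h : G) * x * g)) := by
    intro f x
    simp [T]
  have hmem : ∀ f, T f ∈ Representation.coindV H.subtype ρ := by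
    intro f k x
    rw [hT, hT, map_smul, map_sum]
    congr 1
    refine Fintype.sum_equiv (Equiv.mulRight k) _ _ fun h => ?_
    rw [← Module.End.mul_apply, ← map_mul]
    simp [mul_assoc]
  have hres : Representation.coind H.subtype ρ g = T.restrict (fun f _ => hmem f) := by
    refine LinearMap.ext fun f => Subtype.ext (funext fun x => ?_)
    change f.1 (x * g) = T f.1 x
    have hf : ∀ h : H, ρ h⁻¹ (f.1 ((h : G) * x * g)) = f.1 (x * g) := by
      intro h
      have h1 : f.1 ((h : G) * (x * g)) = ρ h (f.1 (x * g)) := f.2 h (x * g)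
      rw [mul_assoc, h1, ← Module.End.mul_apply, ← map_mul]
      simp
    rw [hT, Finset.sum_congr rfl fun h _ => hf h, Finset.sum_const, Finset.card_univ,
      ← Nat.card_eq_fintype_card, ← Nat.cast_smul_eq_nsmul K, smul_smul, inv_mul_cancel₀ hcard,
      one_smul]
  rw [Representation.character, hres, LinearMap.trace_restrict_eq_of_forall_mem _ T hmem,
    trace_pi_eq_sum, indFun, Finset.mul_sum]
  refine Finset.sum_congr rfl fun x _ => ?_
  by_cases hx : x * g * x⁻¹ ∈ H
  · have : LinearMap.proj x ∘ₗ T ∘ₗ LinearMap.single K (fun _ => V) x =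
        (Nat.card H : K)⁻¹ • ρ ⟨x * g * x⁻¹, hx⟩ := by
      refine LinearMap.ext fun v => ?_
      simp only [LinearMap.comp_apply, LinearMap.proj_apply, hT, LinearMap.single_apply,
        LinearMap.smul_apply]
      congr 1
      rw [Finset.sum_eq_single (⟨x * g * x⁻¹, hx⟩⁻¹ : H)]
      · simp [mul_assoc]
      · intro h _ hne
        rw [Pi.single_eq_of_ne, map_zero]
        intro h1
        apply hne
        apply Subtype.ext
        change (h : G) = (x * g * x⁻¹)⁻¹
        rw [eq_inv_iff_mul_eq_one, ← mul_assoc, ← mul_assoc, h1, mul_inv_cancel]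
      · simp
    rw [this, dif_pos hx, map_smul]
    rfl
  · have : LinearMap.proj x ∘ₗ T ∘ₗ LinearMap.single K (fun _ => V) x = 0 := by
      refine LinearMap.ext fun v => ?_
      simp only [LinearMap.comp_apply, LinearMap.proj_apply, hT, LinearMap.single_apply,
        LinearMap.zero_apply]
      rw [Finset.sum_eq_zero, smul_zero]
      intro h _
      rw [Pi.single_eq_of_ne, map_zero]
      intro h1
      apply hx
      have h2 : x * g * x⁻¹ = (h : G)⁻¹ := by
        rw [eq_comm, inv_eq_iff_mul_eq_one, ← mul_assoc, ← mul_assoc, h1, mul_inv_cancel]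
      rw [h2]
      exact H.inv_mem h.2
    rw [this, dif_neg hx, map_zero, mul_zero]

/-- The class of the induced representation `K[G] ⊗_{K[H]} V` is given by Frobenius' formula. -/
theorem character_ind [Fintype G] [CharZero K] (H : Subgroup G) {V : Type u} [AddCommGroup V]
    [Module K V] [FiniteDimensional K V] (ρ : Representation K H V) :
    (Representation.ind H.subtype ρ).character = indFun H ρ.character := by
  classical
  rw [← character_coind]
  exact Representation.char_iso (Representation.equivOfIso (Rep.indCoindIso (Rep.of ρ)))

/-- Induction `R_K(H) → R_K(G)`; by `ind_ofRep` it is the additive map that sends the class of a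
representation of `H` to the class of the induced representation. -/
def ind [Fintype G] [CharZero K] (H : Subgroup G) : CharRing K H →+ CharRing K G where
  toFun f := ⟨indFun H f.1, by
    obtain ⟨m, n, ρ, σ, rfl⟩ := exists_eq_ofRep_sub_ofRep f
    refine ⟨indFun H ρ.character, indFun H σ.character, ?_, ?_, ?_⟩
    · exact character_coind H ρ ▸ isCharacter_character (Representation.coind H.subtype ρ)
    · exact character_coind H σ ▸ isCharacter_character (Representation.coind H.subtype σ)
    · exact indFun_sub H ρ.character σ.character⟩
  map_zero' := Subtype.ext (indFun_zero H)
  map_add' f₁ f₂ := Subtype.ext (indFun_add H f₁.1 f₂.1)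

theorem ind_ofRep [Fintype G] [CharZero K] (H : Subgroup G) {V : Type u} [AddCommGroup V]
    [Module K V] [FiniteDimensional K V] (ρ : Representation K H V) :
    ind H (ofRep ρ) = ofRep (Representation.ind H.subtype ρ) :=
  Subtype.ext (character_ind H ρ).symm

end

/-! ### The Grothendieck filtration and its topology -/

section

variable (K : Type u) (G : Type v) [Field K] [Group G]

/-- The augmentation ideal of `R_K(G)`: the virtual characters of degree `0`. -/
def augIdeal : Ideal (CharRing K G) := RingHom.ker (augmentation K G)

/-- The `n`-th step `Γⁿ` of the Grothendieck filtration: the additive subgroup generated by the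
monomials `γ^{n₁}(x₁) ⋯ γ^{nₖ}(xₖ)` with all `xᵢ` in the augmentation ideal and
`n₁ + ⋯ + nₖ ≥ n`. A monomial is encoded as the list of the pairs `(nᵢ, xᵢ)`. -/
def gammaFiltration (n : ℕ) : AddSubgroup (CharRing K G) :=
  AddSubgroup.closure
    {y | ∃ l : List (ℕ × CharRing K G), (∀ p ∈ l, p.2 ∈ augIdeal K G) ∧
      n ≤ (l.map Prod.fst).sum ∧ y = (l.map fun p => gammaOp p.1 p.2).prod}

variable {K G}

theorem gammaFiltration_antitone : Antitone (gammaFiltration K G) := fun _ _ hmn =>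
  AddSubgroup.closure_mono fun _ ⟨l, hl, hn, hy⟩ => ⟨l, hl, hmn.trans hn, hy⟩

theorem mul_mem_gammaFiltration {n : ℕ} (r : CharRing K G) {y : CharRing K G}
    (hy : y ∈ gammaFiltration K G n) : r * y ∈ gammaFiltration K G n := by
  induction hy using AddSubgroup.closure_induction with
  | mem y h =>
    obtain ⟨l, hl, hn, rfl⟩ := h
    obtain ⟨d, hd⟩ := exists_int_augmentation r
    set y := (l.map fun p => gammaOp p.1 p.2).prod with hy
    have hr : r - (d : CharRing K G) ∈ augIdeal K G := by
      rw [augIdeal, RingHom.mem_ker, map_sub, hd, map_intCast, sub_self]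
    have h1 : (r - (d : CharRing K G)) * y ∈ gammaFiltration K G n := by
      refine AddSubgroup.subset_closure ⟨(1, r - (d : CharRing K G)) :: l, ?_, ?_, ?_⟩
      · intro p hp
        rcases List.mem_cons.1 hp with rfl | hp
        · exact hr
        · exact hl p hp
      · simp only [List.map_cons, List.sum_cons]; omega
      · simp only [List.map_cons, List.prod_cons, gammaOp_one, hy]
    have h0 : y ∈ gammaFiltration K G n := AddSubgroup.subset_closure ⟨l, hl, hn, hy⟩
    have h2 : d • y ∈ gammaFiltration K G n := AddSubgroup.zsmul_mem _ h0 d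
    have h3 : r * y = (r - (d : CharRing K G)) * y + d • y := by
      rw [zsmul_eq_mul]; ring
    exact h3 ▸ add_mem h1 h2
  | zero => simp
  | add a b _ _ ha hb => rw [mul_add]; exact add_mem ha hb
  | neg a _ ha => rw [mul_neg]; exact neg_mem ha

variable (K G)

theorem gammaFiltration_basis : RingSubgroupsBasis (gammaFiltration K G) :=
  RingSubgroupsBasis.of_comm (gammaFiltration K G)
    (fun i j => ⟨max i j, le_inf (gammaFiltration_antitone (le_max_left i j))
      (gammaFiltration_antitone (le_max_right i j))⟩)
    (fun i => ⟨i, by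
      rintro z ⟨a, _, b, hb, rfl⟩
      exact mul_mem_gammaFiltration a hb⟩)
    (fun x i => ⟨i, fun _ hy => mul_mem_gammaFiltration x hy⟩)

/-- The topology on `R_K(G)` in which the subgroups `Γⁿ` form a basis of
neighbourhoods of `0`. -/
instance : TopologicalSpace (CharRing K G) := (gammaFiltration_basis K G).topology

instance : IsTopologicalRing (CharRing K G) :=
  (gammaFiltration_basis K G).toRingFilterBasis.isTopologicalRing

instance : UniformSpace (CharRing K G) :=
  IsTopologicalAddGroup.rightUniformSpace (CharRing K G)

instance : IsUniformAddGroup (CharRing K G) := isUniformAddGroup_of_addCommGroup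

/-- The completed character ring: the completion of `R_K(G)` for the Grothendieck topology. -/
abbrev CompletedCharRing : Type (max u v) := UniformSpace.Completion (CharRing K G)

end

end VirtualCharacter

end

/-! Everything reduces to powers of the augmentation ideal `I`. Clearly `I ^ n ⊆ Γⁿ`, since `γ¹` is
the identity. Conversely, `I` is additively generated by the elements `[ρ] - dim ρ` with `dim ρ ≤
|G|`, and for these `γ_t` is a polynomial of degree at most `dim ρ`. Multiplicativity of `γ_t` then
gives `γⁱ(x) ∈ I ^ ⌈i/|G|⌉` for all `x ∈ I`, so `Γ^(|G| n) ⊆ I ^ n` and the topology is `I`-adic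
(`mem_augIdeal_pow_of_mem_gammaFiltration`).

For continuity of induction, let `J` be the ideal of `R(H)` generated by the restriction of `I_G`.
Every representation `ρ` of `H` is a quotient of some restricted `σ`, so modulo `J` the polynomial
`γ_t(ρ - dim ρ)` divides `γ_t` of an element of `J`, which is `1`. The coefficients of positive
degree of a unit polynomial are nilpotent, so `ρ - dim ρ` is nilpotent modulo `J`. As `I_H` is
finitely generated, some power of it lies in `J` (`exists_augIdeal_pow_le`), and the projection
formula `ind (res a * b) = a * ind b` carries `J ^ n` into `I_G ^ n`.

For surjectivity, the indices of the members of `X` generate the unit ideal of `ℤ`, so some integral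
combination `u` of the elements `ind_H 1` has degree `1`. Then `1 - u ∈ I_G`, and a geometric series
inverts `u` in the completion. The projection formula, extended by density, shows that multiples of
`u` are in the image. -/

noncomputable section

namespace VirtualCharacter

open Module PowerSeries

universe u v w

/-! ### Traces, exterior powers and eigenvalues. -/

section LinearAlgebra

variable {K : Type u} [Field K] {V : Type v} [AddCommGroup V] [Module K V] [FiniteDimensional K V]
  {W : Type w} [AddCommGroup W] [Module K W] [FiniteDimensional K W]

/-- For a linear section `s` of `π`, split `f` as `(f - f s π) + f s π`. The first term maps into
the kernel and agrees with `f` there; the second has the trace of `π f s = g` by cyclicity. -/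
theorem trace_eq_trace_ker_add_trace {f : V →ₗ[K] V} {g : W →ₗ[K] W} {π : V →ₗ[K] W}
    (hπ : Function.Surjective π) (h : g ∘ₗ π = π ∘ₗ f)
    (hf : ∀ v ∈ LinearMap.ker π, f v ∈ LinearMap.ker π) :
    LinearMap.trace K V f =
      LinearMap.trace K (LinearMap.ker π) (f.restrict hf) + LinearMap.trace K W g := by
  obtain ⟨s, hs⟩ := π.exists_rightInverse_of_surjective (LinearMap.range_eq_top.2 hπ)
  have hs' : ∀ w, π (s w) = w := fun w => LinearMap.congr_fun hs w
  have h' : ∀ v, π (f v) = g (π v) := fun v => (LinearMap.congr_fun h v).symm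
  have hmem : ∀ v, (f - f ∘ₗ s ∘ₗ π) v ∈ LinearMap.ker π := fun v => by
    simp [LinearMap.mem_ker, h', hs']
  have h1 : f = (f - f ∘ₗ s ∘ₗ π) + (f ∘ₗ s) ∘ₗ π := by
    rw [LinearMap.comp_assoc, sub_add_cancel]
  have h2 : LinearMap.trace K V ((f ∘ₗ s) ∘ₗ π) = LinearMap.trace K W g := by
    rw [LinearMap.trace_comp_comm', ← LinearMap.comp_assoc, ← h, LinearMap.comp_assoc, hs,
      LinearMap.comp_id]
  have h3 : f.restrict hf = (f - f ∘ₗ s ∘ₗ π).restrict fun v _ => hmem v := by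
    refine LinearMap.ext fun v => Subtype.ext ?_
    have hv : π (v : V) = 0 := v.2
    simp [LinearMap.restrict_apply, hv]
  rw [h3, LinearMap.trace_restrict_eq_of_forall_mem _ _ hmem, ← h2, ← map_add, ← h1]

omit [FiniteDimensional K V] in
-- In the basis of wedges of basis vectors, the diagonal entries of the exterior power are the
-- principal `n × n` minors, whose sum is the coefficient in question.
theorem trace_exteriorPower_map {ι : Type*} [Fintype ι] [LinearOrder ι]
    (b : Basis ι K V) (f : V →ₗ[K] V) (n : ℕ) :
    LinearMap.trace K (⋀[K]^n V) (exteriorPower.map n f) =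
      (Matrix.det (1 + (Polynomial.X : Polynomial K) •
        (LinearMap.toMatrix b b f).map Polynomial.C)).coeff n := by
  rw [Matrix.coeff_det_one_add_X_smul_eq_sum_minors,
    LinearMap.trace_eq_matrix_trace K (b.exteriorPower n), Matrix.trace]
  refine Finset.sum_bij (fun s _ => (s : Finset ι)) (fun s _ => by simp)
    (fun s _ t _ h => Subtype.ext h)
    (fun s hs => ⟨⟨s, (Finset.mem_powersetCard.1 hs).2⟩, Finset.mem_univ _, rfl⟩) fun s _ => ?_
  have hbij : Function.Bijective fun i : Fin n =>
      (⟨Set.powersetCard.ofFinEmbEquiv.symm s i,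
        (Set.powersetCard.mem_range_ofFinEmbEquiv_symm_iff_mem s _).1 ⟨i, rfl⟩⟩ : (s : Finset ι)) := by
    refine (Fintype.bijective_iff_injective_and_card _).2 ⟨fun i j h => ?_, by simp⟩
    exact (Set.powersetCard.ofFinEmbEquiv.symm s).injective (Subtype.ext_iff.1 h)
  rw [← Matrix.det_submatrix_equiv_self (Equiv.ofBijective _ hbij), ← Matrix.det_transpose,
    Matrix.diag_apply, LinearMap.toMatrix_apply, exteriorPower.basis_repr_apply,
    exteriorPower.basis_apply, exteriorPower.map_apply_ιMulti_family,
    exteriorPower.ιMulti_family, exteriorPower.ιMultiDual_apply_ιMulti]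
  congr 1
  ext i j
  simp [LinearMap.toMatrix_apply]

/-- In characteristic zero `X ^ m - 1` is separable, so `f` is semisimple and its generalized
eigenspaces, which span, are eigenspaces. A basis is then extracted from the set of all
eigenvectors. -/
theorem exists_eigenbasis [CharZero K] [IsAlgClosed K] {f : Module.End K V} {m : ℕ} (hm : m ≠ 0)
    (hf : f ^ m = 1) :
    ∃ (n : ℕ) (b : Basis (Fin n) K V) (d : Fin n → K), ∀ i, f (b i) = d i • b i := by
  have hss : f.IsSemisimple := by
    refine Module.End.isSemisimple_of_squarefree_aeval_eq_zero
      (p := Polynomial.X ^ m - 1) ?_ (by simp [hf])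
    exact (Polynomial.separable_X_pow_sub_C (1 : K) (Nat.cast_ne_zero.2 hm) one_ne_zero).squarefree
  have htop : ⊤ ≤ Submodule.span K {v | ∃ μ : K, f v = μ • v} := by
    rw [← Module.End.iSup_maxGenEigenspace_eq_top f, iSup_le_iff]
    intro μ v hv
    rw [hss.isFinitelySemisimple.maxGenEigenspace_eq_eigenspace, Module.End.mem_eigenspace_iff] at hv
    exact Submodule.subset_span ⟨μ, hv⟩
  let b := Basis.ofSpan htop
  have hb : ∀ i, ∃ μ : K, f (b i) = μ • b i := fun i =>
    Basis.ofSpan_subset htop (Set.mem_range_self i)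
  choose d hd using hb
  have := FiniteDimensional.fintypeBasisIndex b
  let e := Fintype.equivFin ((linearIndepOn_empty K id).extend
    (Set.empty_subset {v | ∃ μ : K, f v = μ • v}))
  exact ⟨_, b.reindex e, d ∘ e.symm, fun i => by simpa using hd _⟩

/-- After base change to `L` the map is diagonal. The point is that one multiset governs both the
traces of powers, which the character sees, and the traces on exterior powers. -/
theorem exists_eigenvalues (L : Type w) [Field L] [CharZero L] [IsAlgClosed L] [Algebra K L] {f : Module.End K V} {m : ℕ} (hm : m ≠ 0)
    (hf : f ^ m = 1) :
    ∃ s : Multiset L, (∀ r ∈ s, r ^ m = 1) ∧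
      (∀ k, algebraMap K L (LinearMap.trace K V (f ^ k)) = (s.map (· ^ k)).sum) ∧
      ∀ n, algebraMap K L (LinearMap.trace K (⋀[K]^n V) (exteriorPower.map n f)) =
        (s.map fun r => 1 + Polynomial.C r * Polynomial.X).prod.coeff n := by
  let F : Module.End L (TensorProduct K L V) := f.baseChange L
  have hpow : ∀ k, F ^ k = (f ^ k).baseChange L := fun k =>
    (map_pow (Module.End.baseChangeHom K L V) f k).symm
  have hF : F ^ m = 1 := by
    rw [hpow, hf]; exact map_one (Module.End.baseChangeHom K L V)
  obtain ⟨N, c, d, hd⟩ := exists_eigenbasis hm hF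
  have hdk : ∀ k i, (F ^ k) (c i) = d i ^ k • c i := by
    intro k i
    induction k with
    | zero => simp
    | succ k ih => rw [pow_succ, Module.End.mul_apply, hd, map_smul, ih, smul_smul, pow_succ']
  have hmat : ∀ k, LinearMap.toMatrix c c (F ^ k) = Matrix.diagonal fun i => d i ^ k := by
    intro k
    ext i j
    rw [LinearMap.toMatrix_apply, hdk, map_smul, Basis.repr_self]
    by_cases h : i = j
    · subst h; simp
    · simp [Matrix.diagonal_apply_ne _ h, Ne.symm h]
  refine ⟨Finset.univ.val.map d, ?_, fun k => ?_, fun n => ?_⟩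
  · intro r hr
    obtain ⟨i, -, rfl⟩ := Multiset.mem_map.1 hr
    have h := congrFun (congrFun (hmat m) i) i
    rwa [hF, LinearMap.toMatrix_one, Matrix.one_apply_eq, Matrix.diagonal_apply_eq,
      eq_comm] at h
  · rw [← LinearMap.trace_baseChange, ← hpow, LinearMap.trace_eq_matrix_trace L c, hmat,
      Matrix.trace_diagonal, Multiset.map_map]
    rfl
  · let b := finBasis K V
    have hb : LinearMap.toMatrix (Algebra.TensorProduct.basis L b) (Algebra.TensorProduct.basis L b) F =
        (LinearMap.toMatrix b b f).map (algebraMap K L) := LinearMap.toMatrix_baseChange L f b b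
    have h1 := trace_exteriorPower_map (Algebra.TensorProduct.basis L b) F n
    rw [trace_exteriorPower_map c, hb] at h1
    have h2 : (Matrix.det (1 + (Polynomial.X : Polynomial K) •
        (LinearMap.toMatrix b b f).map Polynomial.C)).map (algebraMap K L) =
        Matrix.det (1 + (Polynomial.X : Polynomial L) •
          ((LinearMap.toMatrix b b f).map (algebraMap K L)).map Polynomial.C) := by
      rw [← Polynomial.coe_mapRingHom, RingHom.map_det]
      congr 1
      ext i j : 1
      by_cases h : i = j
      · subst h; simp
      · simp [h]
    rw [trace_exteriorPower_map b, ← Polynomial.coeff_map, h2, ← h1]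
    have h3 := hmat 1
    simp only [pow_one] at h3
    have h4 : (1 + (Polynomial.X : Polynomial L) • (Matrix.diagonal d).map Polynomial.C) =
        Matrix.diagonal fun i => 1 + Polynomial.C (d i) * Polynomial.X := by
      ext i j : 1
      by_cases h : i = j
      · subst h; simp [Polynomial.X_mul_C]
      · simp [h]
    rw [h3, h4, Matrix.det_diagonal, Multiset.map_map]
    rfl

/-- The homomorphisms `k ↦ r ^ k` for distinct `r` are linearly independent (Dedekind), and
multiplicities can be read off in characteristic zero. -/
theorem _root_.Multiset.eq_of_sum_map_pow_eq [CharZero K] {s t : Multiset K}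
    (h : ∀ k : ℕ, (s.map (· ^ k)).sum = (t.map (· ^ k)).sum) : s = t := by
  classical
  have hsum : ∀ (u : Multiset K) (k : ℕ), u ≤ s + t → (u.map (· ^ k)).sum =
      ∑ r ∈ (s + t).toFinset, (u.count r : K) * r ^ k := by
    intro u k hu
    rw [Finset.sum_multiset_map_count]
    refine Finset.sum_subset_zero_on_sdiff (Multiset.toFinset_subset.2 (Multiset.subset_of_le hu))
      (fun r hr => ?_) fun r _ => by simp
    have : r ∉ u := fun h => (Finset.mem_sdiff.1 hr).2 (Multiset.mem_toFinset.2 h)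
    simp [Multiset.count_eq_zero_of_notMem this]
  have hli := linearIndependent_monoidHom (Multiplicative ℕ) K
  have hli' := hli.comp (fun r : K => powersHom K r) (powersHom K).injective
  rw [linearIndependent_iff'] at hli'
  ext r
  by_cases hr : r ∈ s + t
  · have := hli' (s + t).toFinset (fun r => (s.count r : K) - t.count r) ?_ r
      (Multiset.mem_toFinset.2 hr)
    · exact_mod_cast sub_eq_zero.1 this
    · funext k
      have h1 := h (Multiplicative.toAdd k)
      rw [hsum s _ (Multiset.le_add_right _ _), hsum t _ (Multiset.le_add_left _ _),
        ← sub_eq_zero, ← Finset.sum_sub_distrib] at h1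
      simpa [Finset.sum_apply, sub_mul] using h1
  · rw [Multiset.mem_add, not_or] at hr
    rw [Multiset.count_eq_zero_of_notMem hr.1, Multiset.count_eq_zero_of_notMem hr.2]

end LinearAlgebra

/-! ### The series `λ_t`: independence of representatives and multiplicativity. -/

section

variable {K : Type u} {G : Type v} [Field K] [Group G]

theorem charRing_ext {x y : CharRing K G} (h : ∀ g, x.1 g = y.1 g) : x = y :=
  Subtype.ext (funext h)

/-- The value of a virtual character at `g`, in the algebraic closure of `K`. -/
def evalAt (g : G) : CharRing K G →+* AlgebraicClosure K :=
  (algebraMap K (AlgebraicClosure K)).comp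
    ((Pi.evalRingHom (fun _ : G => K) g).comp (virtualCharacters K G).subtype)

theorem evalAt_apply (g : G) (x : CharRing K G) :
    evalAt g x = algebraMap K (AlgebraicClosure K) (x.1 g) := rfl

theorem evalAt_ext {x y : CharRing K G} (h : ∀ g, evalAt g x = evalAt g y) : x = y :=
  charRing_ext fun g => (algebraMap K (AlgebraicClosure K)).injective (h g)

theorem map_evalAt_ext {f f' : PowerSeries (CharRing K G)}
    (h : ∀ g, map (evalAt g) f = map (evalAt g) f') : f = f' := by
  ext n : 1
  refine evalAt_ext fun g => ?_
  rw [← coeff_map, h, coeff_map]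

section ofRep

variable {V : Type*} [AddCommGroup V] [Module K V] [FiniteDimensional K V]
  {W : Type*} [AddCommGroup W] [Module K W] [FiniteDimensional K W]

theorem augmentation_ofRep (ρ : Representation K G V) :
    augmentation K G (ofRep ρ) = finrank K V :=
  ρ.char_one

theorem ofRep_prod (ρ : Representation K G V) (σ : Representation K G W) :
    ofRep (ρ.prod σ) = ofRep ρ + ofRep σ :=
  charRing_ext fun g => LinearMap.trace_prodMap' (ρ g) (σ g)

theorem ofRep_trivial : ofRep (Representation.trivial K G V) = (finrank K V : CharRing K G) := by
  refine charRing_ext fun g => ?_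
  change LinearMap.trace K V LinearMap.id = ((finrank K V : virtualCharacters K G) : G → K) g
  rw [LinearMap.trace_id]
  simp

theorem coeff_one_add_X_pow {R : Type*} [CommRing R] (d n : ℕ) :
    coeff n ((1 + X : PowerSeries R) ^ d) = (d.choose n : R) := by
  rw [← Polynomial.coeff_one_add_X_pow R d n, ← Polynomial.coeff_coe]
  simp

theorem lambdaSeries_trivial :
    lambdaSeries (Representation.trivial K G V) = (1 + X) ^ finrank K V := by
  ext n : 1
  have h : extPower (Representation.trivial K G V) n = Representation.trivial K G (⋀[K]^n V) := by
    ext g : 1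
    exact exteriorPower.map_id
  rw [lambdaSeries, coeff_mk, coeff_one_add_X_pow, h, ofRep_trivial, exteriorPower.finrank_eq]

theorem map_augmentation_lambdaSeries (ρ : Representation K G V) :
    map (augmentation K G) (lambdaSeries ρ) = (1 + X) ^ finrank K V := by
  ext n : 1
  rw [coeff_map, lambdaSeries, coeff_mk, coeff_one_add_X_pow, augmentation_ofRep,
    exteriorPower.finrank_eq]

theorem coeff_lambdaSeries_eq_zero (ρ : Representation K G V) {n : ℕ} (hn : finrank K V < n) :
    coeff n (lambdaSeries ρ) = 0 := by
  have h : finrank K (⋀[K]^n V) = 0 := by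
    rw [exteriorPower.finrank_eq, Nat.choose_eq_zero_of_lt hn]
  have := finrank_zero_iff.1 h
  rw [lambdaSeries, coeff_mk]
  refine charRing_ext fun g => ?_
  change LinearMap.trace K _ (extPower ρ n g) = 0
  rw [Subsingleton.elim (extPower ρ n g) 0, map_zero]

theorem isUnit_lambdaSeries (ρ : Representation K G V) : IsUnit (lambdaSeries ρ) := by
  rw [isUnit_iff_constantCoeff, ← coeff_zero_eq_constantCoeff_apply, lambdaSeries, coeff_mk,
    ofRep_extPower_zero]
  exact isUnit_one

variable [CharZero K] [Finite G]

theorem exists_eigenvalues_evalAt (ρ : Representation K G V) (g : G) :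
    ∃ s : Multiset (AlgebraicClosure K), (∀ r ∈ s, r ^ Nat.card G = 1) ∧
      (∀ k, evalAt (g ^ k) (ofRep ρ) = (s.map (· ^ k)).sum) ∧
      map (evalAt g) (lambdaSeries ρ) =
        ((s.map fun r => 1 + Polynomial.C r * Polynomial.X).prod :
          Polynomial (AlgebraicClosure K)) := by
  have : CharZero (AlgebraicClosure K) := charZero_of_injective_algebraMap
    (algebraMap K (AlgebraicClosure K)).injective
  have hg : ρ g ^ Nat.card G = 1 := by rw [← map_pow, pow_card_eq_one', map_one]
  obtain ⟨s, h1, h2, h3⟩ := exists_eigenvalues (AlgebraicClosure K) Nat.card_pos.ne' hg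
  refine ⟨s, h1, fun k => ?_, ?_⟩
  · rw [← h2, ← map_pow]; rfl
  · ext n : 1
    rw [Polynomial.coeff_coe, ← h3, coeff_map, lambdaSeries, coeff_mk]
    rfl

/-- The values of a character at the powers of `g` are the power sums of the eigenvalues of `g`, so
they determine the eigenvalue multiset and with it `λ_t` at `g`. This makes `lambdaOp` independent
of the chosen representatives. -/
theorem lambdaSeries_mul_lambdaSeries_eq {V' W' : Type*} [AddCommGroup V'] [Module K V']
    [FiniteDimensional K V'] [AddCommGroup W'] [Module K W'] [FiniteDimensional K W']
    {ρ : Representation K G V} {σ : Representation K G W} {ρ' : Representation K G V'}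
    {σ' : Representation K G W'} (h : ofRep ρ + ofRep σ = ofRep ρ' + ofRep σ') :
    lambdaSeries ρ * lambdaSeries σ = lambdaSeries ρ' * lambdaSeries σ' := by
  have : CharZero (AlgebraicClosure K) := charZero_of_injective_algebraMap
    (algebraMap K (AlgebraicClosure K)).injective
  refine map_evalAt_ext fun g => ?_
  obtain ⟨s, -, hs, hs'⟩ := exists_eigenvalues_evalAt ρ g
  obtain ⟨t, -, ht, ht'⟩ := exists_eigenvalues_evalAt σ g
  obtain ⟨a, -, ha, ha'⟩ := exists_eigenvalues_evalAt ρ' g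
  obtain ⟨b, -, hb, hb'⟩ := exists_eigenvalues_evalAt σ' g
  have heq : s + t = a + b := by
    refine Multiset.eq_of_sum_map_pow_eq fun k => ?_
    rw [Multiset.map_add, Multiset.map_add, Multiset.sum_add, Multiset.sum_add, ← hs, ← ht,
      ← ha, ← hb, ← map_add, h, map_add]
  rw [map_mul, map_mul, hs', ht', ha', hb', ← Polynomial.coe_mul, ← Polynomial.coe_mul,
    ← Multiset.prod_add, ← Multiset.prod_add, ← Multiset.map_add, ← Multiset.map_add, heq]

theorem lambdaSeries_prod (ρ : Representation K G V) (σ : Representation K G W) :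
    lambdaSeries (ρ.prod σ) = lambdaSeries ρ * lambdaSeries σ := by
  have h := lambdaSeries_mul_lambdaSeries_eq (ρ := ρ.prod σ) (ρ' := ρ) (σ' := σ)
    (σ := Representation.trivial K G (Fin 0 → K)) (by
      rw [ofRep_prod, ofRep_trivial, finrank_fin_fun, Nat.cast_zero, add_zero])
  rwa [lambdaSeries_trivial, finrank_fin_fun, pow_zero, mul_one] at h

end ofRep

/-- The power series `λ_t(x) = ∑ₙ λⁿ(x) tⁿ`. -/
def lambdaTotal (x : CharRing K G) : PowerSeries (CharRing K G) := mk fun n => lambdaOp n x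

theorem exists_lambdaTotal_eq (x : CharRing K G) :
    ∃ (m n : ℕ) (ρ : Representation K G (Fin m → K)) (σ : Representation K G (Fin n → K)),
      x = ofRep ρ - ofRep σ ∧
        lambdaTotal x = lambdaSeries ρ * invOfUnit (lambdaSeries σ) 1 := by
  refine ⟨_, _, _, _, (exists_eq_ofRep_sub_ofRep x).choose_spec.choose_spec.choose_spec.choose_spec,
    ?_⟩
  ext n : 1
  rw [lambdaTotal, coeff_mk, lambdaOp]

variable [CharZero K] [Finite G]

theorem lambdaTotal_sub_mul {V : Type*} [AddCommGroup V] [Module K V] [FiniteDimensional K V]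
    {W : Type*} [AddCommGroup W] [Module K W] [FiniteDimensional K W]
    (ρ : Representation K G V) (σ : Representation K G W) :
    lambdaTotal (ofRep ρ - ofRep σ) * lambdaSeries σ = lambdaSeries ρ := by
  obtain ⟨_, _, ρ', σ', hx, hL⟩ := exists_lambdaTotal_eq (ofRep ρ - ofRep σ)
  have hσ' : constantCoeff (lambdaSeries σ') = ((1 : (CharRing K G)ˣ) : CharRing K G) := by
    rw [← coeff_zero_eq_constantCoeff_apply, lambdaSeries, coeff_mk, ofRep_extPower_zero,
      Units.val_one]
  have h1 : lambdaSeries ρ' * lambdaSeries σ = lambdaSeries ρ * lambdaSeries σ' :=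
    lambdaSeries_mul_lambdaSeries_eq (by linear_combination -hx)
  have h2 := mul_invOfUnit (lambdaSeries σ') 1 hσ'
  rw [hL]
  linear_combination (invOfUnit (lambdaSeries σ') 1) * h1 + lambdaSeries ρ * h2

theorem lambdaTotal_ofRep {V : Type*} [AddCommGroup V] [Module K V] [FiniteDimensional K V]
    (ρ : Representation K G V) : lambdaTotal (ofRep ρ) = lambdaSeries ρ := by
  have h := lambdaTotal_sub_mul ρ (Representation.trivial K G (Fin 0 → K))
  rwa [lambdaSeries_trivial, ofRep_trivial, finrank_fin_fun, pow_zero, mul_one, Nat.cast_zero,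
    sub_zero] at h

theorem lambdaTotal_add (x y : CharRing K G) :
    lambdaTotal (x + y) = lambdaTotal x * lambdaTotal y := by
  obtain ⟨_, _, ρ, σ, rfl⟩ := exists_eq_ofRep_sub_ofRep x
  obtain ⟨_, _, ρ', σ', rfl⟩ := exists_eq_ofRep_sub_ofRep y
  have h := lambdaTotal_sub_mul (ρ.prod ρ') (σ.prod σ')
  rw [lambdaSeries_prod, lambdaSeries_prod, ofRep_prod, ofRep_prod, add_sub_add_comm] at h
  have h1 := lambdaTotal_sub_mul ρ σ
  have h2 := lambdaTotal_sub_mul ρ' σ'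
  refine ((isUnit_lambdaSeries σ).mul (isUnit_lambdaSeries σ')).mul_right_cancel ?_
  rw [h, ← h1, ← h2]
  ring

theorem lambdaTotal_natCast (n : ℕ) : lambdaTotal (n : CharRing K G) = (1 + X) ^ n := by
  have h := lambdaTotal_ofRep (Representation.trivial K G (Fin n → K))
  rwa [ofRep_trivial, lambdaSeries_trivial, finrank_fin_fun] at h

theorem map_augmentation_lambdaTotal {x : CharRing K G} (hx : x ∈ augIdeal K G) :
    map (augmentation K G) (lambdaTotal x) = 1 := by
  obtain ⟨m, n, ρ, σ, rfl⟩ := exists_eq_ofRep_sub_ofRep x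
  have h := congrArg (map (augmentation K G)) (lambdaTotal_sub_mul ρ σ)
  rw [augIdeal, RingHom.mem_ker, map_sub, augmentation_ofRep, augmentation_ofRep, sub_eq_zero,
    Nat.cast_inj] at hx
  rw [map_mul, map_augmentation_lambdaSeries, map_augmentation_lambdaSeries, hx] at h
  refine (IsUnit.pow _ ?_).mul_right_cancel (h.trans (one_mul _).symm)
  rw [isUnit_iff_constantCoeff]
  simp

end

/-! ### Restriction and its compatibility with `λ_t`. -/

section res

variable {K : Type u} {G : Type v} [Field K] [Group G] (H : Subgroup G)

/-- Restriction of virtual characters to a subgroup. -/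
def res : CharRing K G →+* CharRing K H where
  toFun x := ⟨fun h => x.1 h, by
    obtain ⟨m, n, ρ, σ, rfl⟩ := exists_eq_ofRep_sub_ofRep x
    exact ⟨_, _, ⟨m, ρ.comp H.subtype, rfl⟩, ⟨n, σ.comp H.subtype, rfl⟩, rfl⟩⟩
  map_one' := rfl
  map_mul' _ _ := rfl
  map_zero' := rfl
  map_add' _ _ := rfl

variable {H}

theorem res_ofRep {V : Type w} [AddCommGroup V] [Module K V] [FiniteDimensional K V]
    (ρ : Representation K G V) : res H (ofRep ρ) = ofRep (ρ.comp H.subtype) := rfl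

theorem map_res_lambdaSeries {V : Type w} [AddCommGroup V] [Module K V] [FiniteDimensional K V]
    (ρ : Representation K G V) :
    map (res H) (lambdaSeries ρ) = lambdaSeries (ρ.comp H.subtype) := by
  ext n : 1
  rw [coeff_map, lambdaSeries, coeff_mk, lambdaSeries, coeff_mk]
  rfl

theorem map_res_lambdaTotal [CharZero K] [Finite G] (x : CharRing K G) :
    map (res H) (lambdaTotal x) = lambdaTotal (res H x) := by
  obtain ⟨m, n, ρ, σ, rfl⟩ := exists_eq_ofRep_sub_ofRep x
  have h := congrArg (map (res H)) (lambdaTotal_sub_mul ρ σ)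
  rw [map_mul, map_res_lambdaSeries, map_res_lambdaSeries] at h
  rw [map_sub, res_ofRep, res_ofRep]
  exact (isUnit_lambdaSeries _).mul_right_cancel (h.trans (lambdaTotal_sub_mul _ _).symm)

end res

/-! ### The substitution of `t / (1 - t)`. -/

section Substitution

variable {R : Type u} [CommRing R]

/-- The power series `t / (1 - t)`. -/
def gammaParam (R : Type u) [CommRing R] : PowerSeries R := X * mk 1

theorem hasSubst_gammaParam : HasSubst (gammaParam R) :=
  HasSubst.of_constantCoeff_zero' (by simp [gammaParam])

/-- For `1 ≤ i ≤ n + 1` both sides are the binomial coefficient `n` over `i - 1`, by symmetry of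
binomials; otherwise both vanish. -/
theorem coeff_gammaParam_pow (i n : ℕ) :
    coeff (n + 1) (gammaParam R ^ i) = coeff (n + 1) (X ^ i * (1 + X) ^ n : PowerSeries R) := by
  rw [gammaParam, mul_pow, coeff_X_pow_mul', coeff_X_pow_mul']
  split_ifs with h
  · cases i with
    | zero =>
      simp only [pow_zero, coeff_one, coeff_one_add_X_pow]
      simp
    | succ i =>
      rw [mk_one_pow_eq_mk_choose_add, coeff_mk, coeff_one_add_X_pow]
      have hi : i ≤ n := by omega
      rw [Nat.add_sub_add_right, Nat.add_sub_cancel' hi, Nat.choose_symm hi]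
  · rfl

/-- With `f = λ_t(x)` the right side is `λ^(n+1)(x + n) = γ^(n+1)(x)`, which is why `γ_t` is `λ_t`
with `t / (1 - t)` substituted. -/
theorem coeff_subst_gammaParam (f : PowerSeries R) (n : ℕ) :
    coeff (n + 1) (f.subst (gammaParam R)) = coeff (n + 1) (f * (1 + X) ^ n) := by
  have h1 : ∀ i ∉ Finset.range (n + 2),
      coeff i f • coeff (n + 1) (gammaParam R ^ i) = 0 := fun i hi => by
    rw [gammaParam, mul_pow, coeff_X_pow_mul', if_neg (by rw [Finset.mem_range] at hi; omega), smul_zero]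
  rw [coeff_subst' hasSubst_gammaParam, finsum_eq_sum_of_support_subset (s := Finset.range (n + 2)),
    coeff_mul, Finset.Nat.sum_antidiagonal_eq_sum_range_succ_mk]
  · refine Finset.sum_congr rfl fun i hi => ?_
    have hi' : i ≤ n + 1 := Nat.lt_succ_iff.1 (Finset.mem_range.1 hi)
    rw [coeff_gammaParam_pow, coeff_X_pow_mul', if_pos hi', smul_eq_mul]
  · intro i hi
    by_contra h
    exact hi (h1 i h)

theorem one_add_gammaParam_mul : (1 + gammaParam R) * (1 - X) = 1 := by
  have h := mk_one_mul_one_sub_eq_one R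
  rw [gammaParam]
  linear_combination X * h

end Substitution

/-! ### The series `γ_t`. -/

section

variable {K : Type u} {G : Type v} [Field K] [Group G]

/-- The power series `γ_t(x) = ∑ₙ γⁿ(x) tⁿ`. -/
def gammaTotal (x : CharRing K G) : PowerSeries (CharRing K G) := mk fun n => gammaOp n x

theorem coeff_gammaTotal (x : CharRing K G) (n : ℕ) : coeff n (gammaTotal x) = gammaOp n x :=
  coeff_mk _ _

theorem lambdaOp_zero (x : CharRing K G) : lambdaOp 0 x = 1 := by
  obtain ⟨_, _, ρ, σ, hx, h⟩ := exists_lambdaTotal_eq x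
  have h0 := congrArg (coeff 0) h
  rwa [lambdaTotal, coeff_mk, coeff_zero_eq_constantCoeff_apply, map_mul,
    ← coeff_zero_eq_constantCoeff_apply, lambdaSeries, coeff_mk, ofRep_extPower_zero, constantCoeff_invOfUnit, inv_one, Units.val_one,
    mul_one] at h0

theorem gammaOp_zero (x : CharRing K G) : gammaOp 0 x = 1 := lambdaOp_zero _

variable [CharZero K] [Finite G]

theorem gammaTotal_eq_subst (x : CharRing K G) :
    gammaTotal x = (lambdaTotal x).subst (gammaParam (CharRing K G)) := by
  ext n : 1
  cases n with
  | zero =>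
    rw [coeff_gammaTotal, gammaOp_zero, coeff_subst' hasSubst_gammaParam,
      finsum_eq_single _ 0]
    · rw [lambdaTotal, coeff_mk, lambdaOp_zero]; simp
    · intro i hi
      rw [gammaParam, mul_pow, coeff_X_pow_mul', if_neg (by omega), smul_zero]
  | succ n =>
    rw [coeff_gammaTotal, coeff_subst_gammaParam, ← lambdaTotal_natCast, ← lambdaTotal_add,
      lambdaTotal, coeff_mk, gammaOp]
    congr 1
    push_cast
    ring

theorem gammaTotal_add (x y : CharRing K G) :
    gammaTotal (x + y) = gammaTotal x * gammaTotal y := by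
  rw [gammaTotal_eq_subst, gammaTotal_eq_subst, gammaTotal_eq_subst, lambdaTotal_add,
    subst_mul hasSubst_gammaParam]

theorem gammaTotal_zero : gammaTotal (0 : CharRing K G) = 1 := by
  rw [gammaTotal_eq_subst, ← Nat.cast_zero, lambdaTotal_natCast, pow_zero,
    ← coe_substAlgHom hasSubst_gammaParam, map_one]

theorem gammaTotal_natCast_mul (d : ℕ) :
    gammaTotal (d : CharRing K G) * (1 - X) ^ d = 1 := by
  rw [gammaTotal_eq_subst, lambdaTotal_natCast, ← coe_substAlgHom hasSubst_gammaParam, map_pow,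
    map_add, map_one, substAlgHom_X hasSubst_gammaParam, ← mul_pow, one_add_gammaParam_mul, one_pow]

/-- With `d = dim ρ`, multiplying `γ_t(ρ) = ∑ [Λⁱ ρ] (t / (1 - t))ⁱ`, where `i ≤ d`, by `γ_t(-d) =
(1 - t)^d` clears the denominators: the result is `∑ [Λⁱ ρ] tⁱ (1 - t)^(d - i)`. Both the comparison
of filtrations and the nilpotence argument rest on this finiteness. -/
theorem exists_gammaTotal_ofRep_sub_eq {V : Type*} [AddCommGroup V] [Module K V]
    [FiniteDimensional K V] (ρ : Representation K G V) :
    ∃ p : Polynomial (CharRing K G), p.natDegree ≤ finrank K V ∧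
      gammaTotal (ofRep ρ - (finrank K V : CharRing K G)) = p := by
  set d := finrank K V
  have hsub : gammaTotal (ofRep ρ - (d : CharRing K G)) = gammaTotal (ofRep ρ) * (1 - X) ^ d := by
    have h1 := gammaTotal_add (ofRep ρ - (d : CharRing K G)) d
    rw [sub_add_cancel] at h1
    rw [h1, mul_assoc, gammaTotal_natCast_mul, mul_one]
  have hl : lambdaSeries ρ =
      ∑ i ∈ Finset.range (d + 1), C (coeff i (lambdaSeries ρ)) * X ^ i := by
    ext n : 1
    rw [map_sum]
    simp only [coeff_C_mul, coeff_X_pow, mul_ite, mul_one, mul_zero, Finset.sum_ite_eq,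
      Finset.mem_range]
    split_ifs with h
    · rfl
    · exact coeff_lambdaSeries_eq_zero ρ (by omega)
  refine ⟨∑ i ∈ Finset.range (d + 1), Polynomial.C (coeff i (lambdaSeries ρ)) *
    (Polynomial.X ^ i * (1 - Polynomial.X) ^ (d - i)), ?_, ?_⟩
  · refine Polynomial.natDegree_sum_le_of_forall_le _ _ fun i hi => ?_
    refine (Polynomial.natDegree_C_mul_le _ _).trans ?_
    have hi' : i ≤ d := Nat.lt_succ_iff.1 (Finset.mem_range.1 hi)
    refine (Polynomial.natDegree_mul_le_of_le (Polynomial.natDegree_X_pow_le i)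
      (Polynomial.natDegree_pow_le_of_le (d - i)
        ((Polynomial.natDegree_sub_le_of_le (m := 0) (n := 1) ?_ ?_)))).trans ?_
    · simp
    · exact Polynomial.natDegree_X_le
    · simp; omega
  · rw [hsub, gammaTotal_eq_subst, lambdaTotal_ofRep]
    conv_lhs => rw [hl]
    rw [← coe_substAlgHom hasSubst_gammaParam, map_sum, Finset.sum_mul, ← Polynomial.coeToPowerSeries.ringHom_apply, map_sum]
    refine Finset.sum_congr rfl fun i hi => ?_
    have hi' : i ≤ d := Nat.lt_succ_iff.1 (Finset.mem_range.1 hi)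
    have hT : gammaParam (CharRing K G) * (1 - X) = X := by
      have h := mk_one_mul_one_sub_eq_one (CharRing K G)
      rw [gammaParam]
      linear_combination X * h
    have hC : (substAlgHom hasSubst_gammaParam) (C (coeff i (lambdaSeries ρ))) =
        C (coeff i (lambdaSeries ρ)) := by
      rw [coe_substAlgHom hasSubst_gammaParam]
      exact subst_C _
    rw [map_mul, hC, map_pow, substAlgHom_X hasSubst_gammaParam, map_mul]
    simp only [Polynomial.coeToPowerSeries.ringHom_apply, Polynomial.coe_C, Polynomial.coe_mul,
      Polynomial.coe_pow, Polynomial.coe_X, Polynomial.coe_sub, Polynomial.coe_one]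
    rw [mul_assoc]
    refine congrArg _ ?_
    conv_lhs => rw [← Nat.add_sub_of_le hi', pow_add, ← mul_assoc, ← mul_pow, hT]

theorem map_augmentation_gammaTotal {x : CharRing K G} (hx : x ∈ augIdeal K G) :
    map (augmentation K G) (gammaTotal x) = 1 := by
  ext n : 1
  cases n with
  | zero => rw [coeff_map, coeff_gammaTotal, gammaOp_zero, map_one, coeff_zero_one]
  | succ n =>
    rw [coeff_map, gammaTotal_eq_subst, coeff_subst_gammaParam, ← coeff_map, map_mul,
      map_augmentation_lambdaTotal hx, one_mul, map_pow, map_add, map_one, map_X,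
      coeff_one_add_X_pow, Nat.choose_succ_self, coeff_one, if_neg (by omega), Nat.cast_zero]

theorem gammaOp_mem_augIdeal {x : CharRing K G} (hx : x ∈ augIdeal K G) {n : ℕ} (hn : n ≠ 0) :
    gammaOp n x ∈ augIdeal K G := by
  rw [augIdeal, RingHom.mem_ker, ← coeff_gammaTotal, ← coeff_map, map_augmentation_gammaTotal hx,
    coeff_one, if_neg hn]

theorem map_res_gammaTotal {H : Subgroup G} (x : CharRing K G) :
    map (res H) (gammaTotal x) = gammaTotal (res H x) := by
  ext n : 1
  have h := congrArg (coeff n) (map_res_lambdaTotal (H := H) (x + (n : CharRing K G) - 1))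
  rwa [coeff_map, lambdaTotal, lambdaTotal, coeff_mk, coeff_mk, map_sub, map_add, map_one,
    map_natCast, ← gammaOp, ← gammaOp, ← coeff_gammaTotal, ← coeff_gammaTotal, ← coeff_map] at h

end

/-! ### Finite generation of the augmentation ideal. -/

section

variable {K : Type u} {G : Type v} [Field K] [Group G]

theorem ofRep_eq_ofRep_ker_add_ofRep {V W : Type*} [AddCommGroup V] [Module K V]
    [FiniteDimensional K V] [AddCommGroup W] [Module K W] [FiniteDimensional K W]
    (ρ : Representation K G V) (σ : Representation K G W) (π : V →ₗ[K] W)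
    (hπ : Function.Surjective π) (h : ∀ g, σ g ∘ₗ π = π ∘ₗ ρ g) :
    ∃ τ : Representation K G (LinearMap.ker π), ofRep ρ = ofRep τ + ofRep σ := by
  have hker : ∀ g, LinearMap.ker π ≤ (LinearMap.ker π).comap (ρ g) := fun g v hv => by
    rw [LinearMap.mem_ker] at hv
    rw [Submodule.mem_comap, LinearMap.mem_ker, ← LinearMap.comp_apply, ← h, LinearMap.comp_apply, hv, map_zero]
  refine ⟨ρ.subrepresentation _ hker, charRing_ext fun g => ?_⟩
  exact trace_eq_trace_ker_add_trace hπ (h g) (hker g)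

variable (K G) in
/-- The classes `[ρ]` of the representations of dimension at most `|G|`. -/
def smallClasses : Set (CharRing K G) :=
  {x | ∃ n ≤ Nat.card G, ∃ ρ : Representation K G (Fin n → K), x = ofRep ρ}

variable (K G) in
/-- The elements `[ρ] - dim ρ` for the representations of dimension at most `|G|`. -/
def augGenerators : Set (CharRing K G) :=
  {x | ∃ n ≤ Nat.card G, ∃ ρ : Representation K G (Fin n → K),
    x = ofRep ρ - (n : CharRing K G)}

variable [CharZero K]

theorem exists_ofRep_fin_eq {V : Type w} [AddCommGroup V] [Module K V] [FiniteDimensional K V]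
    (ρ : Representation K G V) :
    ∃ σ : Representation K G (Fin (finrank K V) → K), ofRep ρ = ofRep σ := by
  obtain ⟨n, σ, h⟩ := isCharacter_character ρ
  have hn : n = finrank K V := by
    have h1 := congrFun h 1
    rw [σ.char_one, ρ.char_one, Nat.cast_inj, finrank_fin_fun] at h1
    exact h1
  subst hn
  exact ⟨σ, Subtype.ext h.symm⟩

variable [Finite G]

/-- The orbit of a nonzero vector spans a subrepresentation of dimension between `1` and `|G|`. If
`d > |G|`, it is proper, and the class of `ρ` is the sum of the classes of this subrepresentation
and of its quotient, both smaller. -/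
theorem ofRep_mem_closure_smallClasses (d : ℕ) : ∀ {V : Type w} [AddCommGroup V] [Module K V]
    [FiniteDimensional K V] (ρ : Representation K G V), finrank K V = d →
      ofRep ρ ∈ AddSubgroup.closure (smallClasses K G) := by
  induction d using Nat.strong_induction_on with
  | _ d ih =>
    intro V _ _ _ ρ hd
    by_cases hsmall : d ≤ Nat.card G
    · obtain ⟨σ, hσ⟩ := exists_ofRep_fin_eq ρ
      exact AddSubgroup.subset_closure ⟨_, hd.le.trans hsmall, σ, hσ⟩
    · have : Fintype G := Fintype.ofFinite G
      have : Nontrivial V := finrank_pos_iff (R := K).1 (by omega)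
      obtain ⟨v, hv⟩ := exists_ne (0 : V)
      let U : Submodule K V := Submodule.span K (Set.range fun g => ρ g v)
      have hU : ∀ g, U ≤ U.comap (ρ g) := fun g => by
        rw [Submodule.span_le]
        rintro _ ⟨g', rfl⟩
        refine Submodule.subset_span ⟨g * g', ?_⟩
        simp
      have hvU : v ∈ U := Submodule.subset_span ⟨1, by simp⟩
      have hUpos : 0 < finrank K U := by
        have : Nontrivial U := ⟨⟨⟨v, hvU⟩, 0, fun h => hv (Subtype.ext_iff.1 h)⟩⟩
        exact finrank_pos
      have hUle : finrank K U ≤ Nat.card G := by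
        rw [Nat.card_eq_fintype_card]
        exact finrank_range_le_card _
      have hsum := U.finrank_quotient_add_finrank
      let σ := ρ.quotient U hU
      obtain ⟨τ, hτ⟩ := ofRep_eq_ofRep_ker_add_ofRep ρ σ U.mkQ U.mkQ_surjective
        fun g => U.mapQ_mkQ U (ρ g) (h := hU g)
      rw [hτ]
      have hker : finrank K (LinearMap.ker U.mkQ) = finrank K U := by rw [U.ker_mkQ]
      exact add_mem (ih _ (by omega) τ hker) (ih _ (by omega) σ rfl)

theorem mem_closure_smallClasses (x : CharRing K G) :
    x ∈ AddSubgroup.closure (smallClasses K G) := by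
  obtain ⟨m, n, ρ, σ, rfl⟩ := exists_eq_ofRep_sub_ofRep x
  exact sub_mem (ofRep_mem_closure_smallClasses _ ρ rfl) (ofRep_mem_closure_smallClasses _ σ rfl)

omit [CharZero K] [Finite G] in
theorem augGenerators_subset : augGenerators K G ⊆ augIdeal K G := by
  rintro _ ⟨n, -, ρ, rfl⟩
  rw [SetLike.mem_coe, augIdeal, RingHom.mem_ker, map_sub, augmentation_ofRep, map_natCast,
    finrank_fin_fun, sub_self]

theorem closure_augGenerators :
    AddSubgroup.closure (augGenerators K G) = (augIdeal K G).toAddSubgroup := by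
  refine le_antisymm ((AddSubgroup.closure_le _).2 augGenerators_subset) fun x hx => ?_
  -- Generation holds up to an integer on all of `R(G)`; on degree `0` elements that integer must
  -- vanish.
  have key : ∀ y : CharRing K G,
      ∃ d : ℤ, y - (d : CharRing K G) ∈ AddSubgroup.closure (augGenerators K G) := by
    intro y
    induction mem_closure_smallClasses y using AddSubgroup.closure_induction with
    | mem y h =>
      obtain ⟨n, hn, ρ, rfl⟩ := h
      exact ⟨n, AddSubgroup.subset_closure ⟨n, hn, ρ, by simp⟩⟩
    | zero => exact ⟨0, by simp⟩
    | add a b _ _ ha hb =>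
      obtain ⟨d, hd⟩ := ha
      obtain ⟨e, he⟩ := hb
      refine ⟨d + e, ?_⟩
      rw [Int.cast_add, add_sub_add_comm]
      exact add_mem hd he
    | neg a _ ha =>
      obtain ⟨d, hd⟩ := ha
      refine ⟨-d, ?_⟩
      rw [Int.cast_neg, ← neg_sub', neg_mem_iff]
      exact hd
  obtain ⟨d, hd⟩ := key x
  have h1 : x - (d : CharRing K G) ∈ augIdeal K G :=
    (AddSubgroup.closure_le (augIdeal K G).toAddSubgroup).2 augGenerators_subset hd
  have hx' : x ∈ augIdeal K G := hx
  rw [augIdeal, RingHom.mem_ker] at h1 hx'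
  rw [map_sub, hx', map_intCast, zero_sub, neg_eq_zero, Int.cast_eq_zero] at h1
  rwa [h1, Int.cast_zero, sub_zero] at hd

theorem finite_augGenerators : (augGenerators K G).Finite := by
  classical
  have : CharZero (AlgebraicClosure K) := charZero_of_injective_algebraMap
    (algebraMap K (AlgebraicClosure K)).injective
  set N := Nat.card G
  have hN : 0 < N := Nat.card_pos
  -- Sums of submultisets of `N` copies of the `N`-th roots of unity: these include all sums of at
  -- most `N` such roots, hence all character values in dimension at most `N`.
  let T : Set (AlgebraicClosure K) := Multiset.sum ''
    ((N • (Polynomial.nthRootsFinset N (1 : AlgebraicClosure K)).val).powerset.toFinset :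
      Set (Multiset (AlgebraicClosure K)))
  have hT : T.Finite := (Finset.finite_toSet _).image _
  have hS : (smallClasses K G).Finite := by
    refine Set.Finite.of_finite_image ((Set.Finite.pi fun _ : G => hT).subset
      (s := Set.pi Set.univ fun _ => T) (t := (fun x g => evalAt g x) '' smallClasses K G) ?_)
      fun x _ y _ h => evalAt_ext fun g => congrFun h g
    rintro _ ⟨_, ⟨n, hn, ρ, rfl⟩, rfl⟩ g -
    obtain ⟨s, hs, hpow, -⟩ := exists_eigenvalues_evalAt ρ g
    have hcard : s.card = n := by
      have h0 := hpow 0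
      rw [pow_zero, evalAt_apply] at h0
      have h1 : (ofRep ρ).1 1 = (n : K) := by
        exact ρ.char_one.trans (by rw [finrank_fin_fun])
      rw [h1, map_natCast] at h0
      simp only [pow_zero, Multiset.map_const', Multiset.sum_replicate, nsmul_eq_mul, mul_one,
        Nat.cast_inj] at h0
      exact h0.symm
    refine ⟨s, ?_, by simpa using (hpow 1).symm⟩
    rw [Finset.mem_coe, Multiset.mem_toFinset, Multiset.mem_powerset, Multiset.le_iff_count]
    intro r
    by_cases hr : r ∈ s
    · rw [Multiset.count_nsmul, Multiset.count_eq_one_of_mem (Finset.nodup _)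
        ((Polynomial.mem_nthRootsFinset hN _).2 (hs r hr)), mul_one]
      exact (Multiset.count_le_card r s).trans (hcard.le.trans hn)
    · rw [Multiset.count_eq_zero_of_notMem hr]
      exact Nat.zero_le _
  have hfin : (Set.image2 (fun (n : ℕ) (x : CharRing K G) => x - (n : CharRing K G)) (Set.Iic N)
      (smallClasses K G)).Finite :=
    Set.Finite.image2 _ (Set.finite_Iic N) hS
  refine hfin.subset ?_
  rintro _ ⟨n, hn, ρ, rfl⟩
  exact ⟨n, hn, _, ⟨n, hn, ρ, rfl⟩, rfl⟩

theorem fg_augIdeal : (augIdeal K G).FG := by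
  refine (Submodule.fg_def).2 ⟨augGenerators K G, finite_augGenerators,
    le_antisymm (Submodule.span_le.2 augGenerators_subset) fun x hx => ?_⟩
  have h : x ∈ AddSubgroup.closure (augGenerators K G) := by
    rw [closure_augGenerators]; exact hx
  exact (AddSubgroup.closure_le (Submodule.span _ _).toAddSubgroup).2 Submodule.subset_span h

end

/-! ### Power series whose coefficients lie in prescribed powers of an ideal. -/

section CoeffFiltration

variable {R : Type u} [CommRing R] (I : Ideal R) (e : ℕ → ℕ)

/-- Subadditivity of `e` is what keeps the condition stable under products. With the companion
statement on inverses, it lets a bound on `γ_t` pass from additive generators to sums and negatives.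
-/
theorem coeff_mul_mem_pow (he : ∀ a b, e (a + b) ≤ e a + e b) {f g : PowerSeries R}
    (hf : ∀ i, coeff i f ∈ I ^ e i) (hg : ∀ i, coeff i g ∈ I ^ e i) (i : ℕ) :
    coeff i (f * g) ∈ I ^ e i := by
  rw [coeff_mul]
  refine sum_mem fun p hp => ?_
  rw [← Finset.HasAntidiagonal.mem_antidiagonal.1 hp]
  refine Ideal.pow_le_pow_right (he _ _) ?_
  rw [pow_add]
  exact Ideal.mul_mem_mul (hf _) (hg _)

theorem coeff_inv_mem_pow (he : ∀ a b, e (a + b) ≤ e a + e b) (he0 : e 0 = 0)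
    {f g : PowerSeries R} (hf : ∀ i, coeff i f ∈ I ^ e i) (hf0 : coeff 0 f = 1)
    (hfg : f * g = 1) (i : ℕ) : coeff i g ∈ I ^ e i := by
  induction i using Nat.strong_induction_on with
  | _ i ih =>
    cases i with
    | zero => rw [he0, pow_zero, Ideal.one_eq_top]; exact Submodule.mem_top
    | succ n =>
      have h := congrArg (coeff (n + 1)) hfg
      rw [coeff_mul, Finset.Nat.sum_antidiagonal_succ, hf0, one_mul, coeff_one,
        if_neg n.succ_ne_zero] at h
      rw [eq_neg_of_add_eq_zero_left h, neg_mem_iff]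
      refine sum_mem fun p hp => ?_
      have hp' := Finset.HasAntidiagonal.mem_antidiagonal.1 hp
      rw [← hp', add_right_comm]
      refine Ideal.pow_le_pow_right (he _ _) ?_
      rw [pow_add]
      exact Ideal.mul_mem_mul (hf _) (ih _ (by omega))

end CoeffFiltration

/-! ### Comparison of the Grothendieck filtration with the powers of the augmentation ideal. -/

section

variable {K : Type u} {G : Type v} [Field K] [Group G]

theorem mul_mem_gammaFiltration_succ {n : ℕ} {b y : CharRing K G} (hb : b ∈ augIdeal K G)
    (hy : y ∈ gammaFiltration K G n) : b * y ∈ gammaFiltration K G (n + 1) := by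
  induction hy using AddSubgroup.closure_induction with
  | mem y h =>
    obtain ⟨l, hl, hn, rfl⟩ := h
    refine AddSubgroup.subset_closure ⟨(1, b) :: l, ?_, ?_, ?_⟩
    · intro p hp
      rcases List.mem_cons.1 hp with rfl | hp
      · exact hb
      · exact hl p hp
    · simp only [List.map_cons, List.sum_cons]; omega
    · simp only [List.map_cons, List.prod_cons, gammaOp_one]
  | zero => simp
  | add a b _ _ ha hb => rw [mul_add]; exact add_mem ha hb
  | neg a _ ha => rw [mul_neg]; exact neg_mem ha

theorem mem_gammaFiltration_of_mem_augIdeal_pow {n : ℕ} {x : CharRing K G}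
    (hx : x ∈ augIdeal K G ^ n) : x ∈ gammaFiltration K G n := by
  induction n generalizing x with
  | zero =>
    have h1 : (1 : CharRing K G) ∈ gammaFiltration K G 0 :=
      AddSubgroup.subset_closure ⟨[], by simp, by simp, by simp⟩
    simpa using mul_mem_gammaFiltration x h1
  | succ n ih =>
    rw [pow_succ'] at hx
    induction hx using Submodule.mul_induction_on' with
    | mem_mul_mem a ha b hb => exact mul_mem_gammaFiltration_succ ha (ih hb)
    | add a _ b _ ha hb => exact add_mem ha hb

variable [CharZero K] [Finite G]

/-- For a generator, `γⁱ` is in `I` when `1 ≤ i ≤ |G|` and is `0` beyond, by the degree bound. Since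
`i ↦ ⌈i/|G|⌉` is subadditive, the estimate extends to all of `I`. -/
theorem gammaOp_mem_augIdeal_pow {x : CharRing K G} (hx : x ∈ augIdeal K G) (i : ℕ) :
    gammaOp i x ∈ augIdeal K G ^ (i ⌈/⌉ Nat.card G) := by
  have hD : 0 < Nat.card G := Nat.card_pos
  have he : ∀ a b, (a + b) ⌈/⌉ Nat.card G ≤ a ⌈/⌉ Nat.card G + b ⌈/⌉ Nat.card G := fun a b => by
    rw [ceilDiv_le_iff_le_mul hD, mul_add]
    exact add_le_add ((ceilDiv_le_iff_le_mul hD).1 le_rfl) ((ceilDiv_le_iff_le_mul hD).1 le_rfl)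
  have hx' : x ∈ AddSubgroup.closure (augGenerators K G) := by
    rw [closure_augGenerators]; exact hx
  rw [← coeff_gammaTotal]
  revert i
  clear hx
  induction hx' using AddSubgroup.closure_induction with
  | mem x h =>
    intro i
    have hxI := augGenerators_subset h
    obtain ⟨n, hn, ρ, rfl⟩ := h
    obtain ⟨p, hp, hpx⟩ := exists_gammaTotal_ofRep_sub_eq ρ
    rw [finrank_fin_fun] at hp hpx
    by_cases hi : i ≤ Nat.card G
    · rcases Nat.eq_zero_or_pos i with rfl | hi0
      · rw [zero_ceilDiv, pow_zero, Ideal.one_eq_top]; exact Submodule.mem_top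
      · have : i ⌈/⌉ Nat.card G ≤ 1 := by rw [ceilDiv_le_iff_le_mul hD, mul_one]; exact hi
        refine Ideal.pow_le_pow_right this ?_
        rw [pow_one, coeff_gammaTotal]
        exact gammaOp_mem_augIdeal hxI hi0.ne'
    · rw [hpx, Polynomial.coeff_coe, Polynomial.coeff_eq_zero_of_natDegree_lt (by omega)]
      exact zero_mem _
  | zero =>
    intro i
    rw [gammaTotal_zero, coeff_one]
    split_ifs with h
    · rw [h, zero_ceilDiv, pow_zero, Ideal.one_eq_top]; exact Submodule.mem_top
    · exact zero_mem _
  | add a b _ _ ha hb => rw [gammaTotal_add]; exact coeff_mul_mem_pow _ (· ⌈/⌉ Nat.card G) he ha hb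
  | neg a _ ha =>
    refine coeff_inv_mem_pow _ (· ⌈/⌉ Nat.card G) he (zero_ceilDiv _) ha ?_ ?_
    · rw [coeff_gammaTotal, gammaOp_zero]
    · rw [← gammaTotal_add, add_neg_cancel, gammaTotal_zero]

theorem mem_augIdeal_pow_of_mem_gammaFiltration {n : ℕ} {x : CharRing K G}
    (hx : x ∈ gammaFiltration K G (Nat.card G * n)) : x ∈ augIdeal K G ^ n := by
  have hD : 0 < Nat.card G := Nat.card_pos
  refine (AddSubgroup.closure_le (augIdeal K G ^ n).toAddSubgroup).2 ?_ hx
  rintro _ ⟨l, hl, hn, rfl⟩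
  have hle : n ≤ (l.map fun p => p.1 ⌈/⌉ Nat.card G).sum := by
    refine Nat.le_of_mul_le_mul_left (hn.trans ?_) hD
    clear hn hl
    induction l with
    | nil => simp
    | cons p l ih =>
      simp only [List.map_cons, List.sum_cons, mul_add]
      exact add_le_add ((ceilDiv_le_iff_le_mul hD).1 le_rfl) ih
  refine Ideal.pow_le_pow_right hle ?_
  clear hn hle
  induction l with
  | nil => simp
  | cons p l ih =>
    simp only [List.map_cons, List.prod_cons, List.sum_cons, pow_add]
    exact Ideal.mul_mem_mul (gammaOp_mem_augIdeal_pow (hl p (by simp)) _)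
      (ih fun q hq => hl q (by simp [hq]))

end

/-! ### The projection formula, continuity, and units of the completion. -/

section

variable {K : Type u} {G : Type v} [Field K] [Group G]

theorem charRing_apply_conj (x : CharRing K G) (g h : G) : x.1 (h * g * h⁻¹) = x.1 g := by
  obtain ⟨m, n, ρ, σ, rfl⟩ := exists_eq_ofRep_sub_ofRep x
  exact congrArg₂ (· - ·) (ρ.char_conj g h) (σ.char_conj g h)

theorem res_mem_augIdeal {H : Subgroup G} {x : CharRing K G} (hx : x ∈ augIdeal K G) :
    res H x ∈ augIdeal K H := hx

variable [CharZero K] [Fintype G] {H : Subgroup G}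

theorem ind_res_mul (a : CharRing K G) (b : CharRing K H) :
    ind H (res H a * b) = a * ind H b := by
  refine charRing_ext fun g => ?_
  change indFun H (fun h : H => a.1 h * b.1 h) g = a.1 g * indFun H b.1 g
  rw [indFun, indFun, mul_left_comm, Finset.mul_sum _ _ (a.1 g)]
  refine congrArg _ (Finset.sum_congr rfl fun x _ => ?_)
  split_ifs with h
  · rw [charRing_apply_conj]
  · rw [mul_zero]

theorem augmentation_ind_one : augmentation K G (ind H 1) = H.index := by
  have hcard : (Nat.card H : K) ≠ 0 := Nat.cast_ne_zero.2 Nat.card_pos.ne'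
  change indFun H (fun _ => (1 : K)) 1 = _
  rw [indFun, inv_mul_eq_iff_eq_mul₀ hcard, ← Nat.cast_mul, Subgroup.card_mul_index]
  simp

/-- Every representation of a subgroup is a quotient of the restriction of a representation
of the whole group. -/
theorem exists_res_ofRep_eq_add {V : Type w} [AddCommGroup V] [Module K V] [FiniteDimensional K V]
    (ρ : Representation K H V) :
    ∃ (m n : ℕ) (σ : Representation K G (Fin m → K)) (τ : Representation K H (Fin n → K)),
      res H (ofRep σ) = ofRep τ + ofRep ρ := by
  classical
  -- Evaluation at `1` on the coinduced representation; a vector is lifted by its orbit function on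
  -- `H`, extended by zero.
  let π : Representation.coindV H.subtype ρ →ₗ[K] V :=
    (LinearMap.proj (1 : G)).comp (Submodule.subtype _)
  have hπ : Function.Surjective π := by
    intro v
    refine ⟨⟨fun x => if hx : x ∈ H then ρ ⟨x, hx⟩ v else 0, fun h x => ?_⟩, ?_⟩
    · change (if hx : (h : G) * x ∈ H then ρ ⟨(h : G) * x, hx⟩ v else 0) =
        ρ h (if hx : x ∈ H then ρ ⟨x, hx⟩ v else 0)
      by_cases hx : x ∈ H
      · rw [dif_pos (H.mul_mem h.2 hx), dif_pos hx, ← Module.End.mul_apply, ← map_mul]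
        rfl
      · rw [dif_neg hx, dif_neg fun h' => hx ((H.mul_mem_cancel_left h.2).1 h'), map_zero]
    · change (if hx : (1 : G) ∈ H then ρ ⟨1, hx⟩ v else 0) = v
      rw [dif_pos H.one_mem]
      exact LinearMap.congr_fun (map_one ρ) v
  have hcomm : ∀ h : H, ρ h ∘ₗ π = π ∘ₗ (Representation.coind H.subtype ρ).comp H.subtype h := by
    intro h
    refine LinearMap.ext fun f => ?_
    change ρ h (f.1 1) = f.1 (1 * h)
    rw [← f.2 h 1, one_mul, mul_one]
    rfl
  obtain ⟨τ, hτ⟩ := ofRep_eq_ofRep_ker_add_ofRep _ ρ π hπ hcomm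
  obtain ⟨σ', hσ'⟩ := exists_ofRep_fin_eq (Representation.coind H.subtype ρ)
  obtain ⟨τ', hτ'⟩ := exists_ofRep_fin_eq (V := LinearMap.ker π) τ
  refine ⟨_, _, σ', τ', ?_⟩
  rw [← hσ', ← hτ', res_ofRep, hτ]

/-- Writing `res σ = τ + ρ`, the polynomials `γ_t(τ - dim τ)` and `γ_t(ρ - d)` multiply to `γ_t(res
(σ - dim σ))`, which is `1` modulo the ideal. So the second is a unit polynomial over the quotient
ring, and its linear coefficient, `ρ - d` itself, is nilpotent there. -/
theorem ofRep_sub_mem_radical {d : ℕ} (ρ : Representation K H (Fin d → K)) :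
    ofRep ρ - (d : CharRing K H) ∈ ((augIdeal K G).map (res H)).radical := by
  obtain ⟨m, n, σ, τ, h⟩ := exists_res_ofRep_eq_add (G := G) ρ
  set J := (augIdeal K G).map (res H) with hJ
  have hdim : m = n + d := by
    have h1 := congrArg (augmentation K H) h
    rw [res_ofRep, map_add, augmentation_ofRep, augmentation_ofRep, augmentation_ofRep,
      finrank_fin_fun, finrank_fin_fun, finrank_fin_fun] at h1
    exact_mod_cast h1
  obtain ⟨p, -, hp⟩ := exists_gammaTotal_ofRep_sub_eq ρ
  obtain ⟨q, -, hq⟩ := exists_gammaTotal_ofRep_sub_eq τ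
  rw [finrank_fin_fun] at hp hq
  have hσ : ofRep σ - (m : CharRing K G) ∈ augIdeal K G := by
    rw [augIdeal, RingHom.mem_ker, map_sub, augmentation_ofRep, map_natCast, finrank_fin_fun,
      sub_self]
  have hmul : gammaTotal (res H (ofRep σ - (m : CharRing K G))) = (q : PowerSeries (CharRing K H)) *
      (p : PowerSeries (CharRing K H)) := by
    rw [← hp, ← hq, ← gammaTotal_add, map_sub, map_natCast, h, hdim]
    push_cast
    ring_nf
  have hone : PowerSeries.map (Ideal.Quotient.mk J)
      (gammaTotal (res H (ofRep σ - (m : CharRing K G)))) = 1 := by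
    rw [← map_res_gammaTotal]
    ext i : 1
    rw [PowerSeries.coeff_map, PowerSeries.coeff_map, coeff_gammaTotal, PowerSeries.coeff_one]
    split_ifs with hi
    · rw [hi, gammaOp_zero, map_one, map_one]
    · exact Ideal.Quotient.eq_zero_iff_mem.2
        (Ideal.mem_map_of_mem _ (gammaOp_mem_augIdeal hσ hi))
  have hunit : IsUnit (p.map (Ideal.Quotient.mk J)) := by
    refine IsUnit.of_mul_eq_one (q.map (Ideal.Quotient.mk J)) (Polynomial.coe_injective _ ?_)
    rw [mul_comm, Polynomial.coe_mul, Polynomial.polynomial_map_coe, Polynomial.polynomial_map_coe,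
      ← map_mul, ← hmul, hone, Polynomial.coe_one]
  have hnil := (Polynomial.isUnit_iff_coeff_isUnit_isNilpotent.1 hunit).2 1 one_ne_zero
  rw [Polynomial.coeff_map, ← Polynomial.coeff_coe, ← hp, coeff_gammaTotal, gammaOp_one] at hnil
  obtain ⟨k, hk⟩ := hnil
  exact ⟨k, by rwa [← map_pow, Ideal.Quotient.eq_zero_iff_mem] at hk⟩

theorem exists_augIdeal_pow_le (H : Subgroup G) :
    ∃ k, augIdeal K H ^ k ≤ (augIdeal K G).map (res H) := by
  refine Ideal.exists_pow_le_of_le_radical_of_fg (fun x hx => ?_) fg_augIdeal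
  have h : x ∈ AddSubgroup.closure (augGenerators K H) := by
    rw [closure_augGenerators]; exact hx
  refine (AddSubgroup.closure_le
    (((augIdeal K G).map (res H)).radical).toAddSubgroup).2 ?_ h
  rintro _ ⟨n, -, ρ, rfl⟩
  exact ofRep_sub_mem_radical ρ

theorem ind_mem_of_mem_map_res {A : Ideal (CharRing K G)} {x : CharRing K H}
    (hx : x ∈ A.map (res H)) : ind H x ∈ A := by
  -- Induction is linear only over `R(G)`, so the multiplier `b ∈ R(H)` must be carried along for
  -- the span induction to go through.
  suffices h : ∀ b, ind H (b * x) ∈ A by simpa using h 1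
  induction hx using Submodule.span_induction with
  | mem x h =>
    obtain ⟨a, ha, rfl⟩ := h
    intro b
    rw [mul_comm, ind_res_mul]
    exact A.mul_mem_right _ ha
  | zero => intro b; rw [mul_zero, map_zero]; exact zero_mem A
  | add x y _ _ hx hy => intro b; rw [mul_add, map_add]; exact add_mem (hx b) (hy b)
  | smul a x _ hx => intro b; rw [smul_eq_mul, ← mul_assoc]; exact hx _

omit [CharZero K] [Fintype G] in
theorem continuous_of_forall_gammaFiltration {G' : Type w} [Group G']
    (f : CharRing K G →+ CharRing K G')
    (h : ∀ n, ∃ N, ∀ x ∈ gammaFiltration K G N, f x ∈ gammaFiltration K G' n) :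
    Continuous f := by
  refine continuous_of_continuousAt_zero f ?_
  rw [ContinuousAt, map_zero]
  refine ((gammaFiltration_basis K G).hasBasis_nhds_zero.tendsto_iff
    (gammaFiltration_basis K G').hasBasis_nhds_zero).2 fun n _ => ?_
  obtain ⟨N, hN⟩ := h n
  exact ⟨N, trivial, hN⟩

/-- The chain is `Γ^(|H| k n) ⊆ I_H ^ (k n)`, which lies in the extension of `I_G ^ n`, which
induction sends into `I_G ^ n ⊆ Γⁿ`. -/
theorem continuous_ind (H : Subgroup G) : Continuous (ind (K := K) H) := by
  obtain ⟨k, hk⟩ := exists_augIdeal_pow_le (K := K) H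
  refine continuous_of_forall_gammaFiltration _ fun n => ⟨Nat.card H * (k * n), fun x hx => ?_⟩
  have h1 : x ∈ augIdeal K H ^ (k * n) := mem_augIdeal_pow_of_mem_gammaFiltration hx
  rw [pow_mul] at h1
  have h2 := Ideal.pow_right_mono hk n h1
  rw [← Ideal.map_pow] at h2
  exact mem_gammaFiltration_of_mem_augIdeal_pow (ind_mem_of_mem_map_res h2)

theorem continuous_res (H : Subgroup G) : Continuous (res (K := K) H).toAddMonoidHom := by
  refine continuous_of_forall_gammaFiltration _ fun n => ⟨Nat.card G * n, fun x hx => ?_⟩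
  refine mem_gammaFiltration_of_mem_augIdeal_pow ?_
  have h := Ideal.mem_map_of_mem (res H) (mem_augIdeal_pow_of_mem_gammaFiltration hx)
  rw [Ideal.map_pow] at h
  exact Ideal.pow_right_mono (Ideal.map_le_iff_le_comap.2 fun _ hy =>
    Ideal.mem_comap.2 (res_mem_augIdeal hy)) n h

instance : NonarchimedeanRing (CharRing K G) := (gammaFiltration_basis K G).nonarchimedean

omit [CharZero K] [Fintype G] in
-- The inverse is the geometric series: the completion is complete and nonarchimedean, so `x ^ n →
-- 0` is enough for summability.
theorem exists_mul_one_sub_eq_one {x : CharRing K G} (hx : x ∈ augIdeal K G) :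
    ∃ s : CompletedCharRing K G, ((1 - x : CharRing K G) : CompletedCharRing K G) * s = 1 := by
  have htend : Filter.Tendsto (fun n : ℕ => x ^ n) Filter.atTop (nhds 0) := by
    refine (gammaFiltration_basis K G).hasBasis_nhds_zero.tendsto_right_iff.2 fun n _ => ?_
    filter_upwards [Filter.eventually_ge_atTop n] with m hm
    exact gammaFiltration_antitone hm
      (mem_gammaFiltration_of_mem_augIdeal_pow (Ideal.pow_mem_pow hx m))
  have hpow : ∀ n : ℕ, ((x ^ n : CharRing K G) : CompletedCharRing K G) =
      (x : CompletedCharRing K G) ^ n := fun n =>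
    map_pow (UniformSpace.Completion.coeRingHom (α := CharRing K G)) x n
  have hsum : Summable fun n : ℕ => (x : CompletedCharRing K G) ^ n := by
    refine NonarchimedeanAddGroup.summable_of_tendsto_cofinite_zero ?_
    rw [Nat.cofinite_eq_atTop, ← UniformSpace.Completion.coe_zero]
    simp only [← hpow]
    exact ((UniformSpace.Completion.continuous_coe (CharRing K G)).tendsto 0).comp htend
  refine ⟨∑' n : ℕ, (x : CompletedCharRing K G) ^ n, ?_⟩
  rw [UniformSpace.Completion.coe_sub, UniformSpace.Completion.coe_one]
  exact hsum.one_sub_mul_tsum_pow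

omit [Field K] [CharZero K] in
-- The index of a Sylow `p`-subgroup is prime to `p`, so no prime divides all the indices.
theorem exists_sum_mul_index_eq_one {X : Set (Subgroup G)}
    (hX : ∀ p : ℕ, p.Prime → ∃ P : Sylow p G, (P : Subgroup G) ∈ X) :
    ∃ c : X →₀ ℤ, (c.sum fun H m => m * ((H : Subgroup G).index : ℤ)) = 1 := by
  have htop : Ideal.span (Set.range fun H : X => ((H : Subgroup G).index : ℤ)) = ⊤ := by
    by_contra hne
    obtain ⟨M, hM, hle⟩ := Ideal.exists_le_maximal _ hne
    obtain ⟨n, rfl⟩ := (IsPrincipalIdealRing.principal M).principal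
    have hdvd : ∀ H : X, n ∣ ((H : Subgroup G).index : ℤ) := fun H =>
      Ideal.mem_span_singleton.1 (hle (Ideal.subset_span ⟨H, rfl⟩))
    -- The case `n = 0` needs no separate treatment: every prime divides `0`.
    have hnu : n.natAbs ≠ 1 := fun h =>
      hM.ne_top (Ideal.span_singleton_eq_top.2 (Int.isUnit_iff_natAbs_eq.2 h))
    obtain ⟨p, hp, hpn⟩ := Nat.exists_prime_and_dvd hnu
    have := Fact.mk hp
    obtain ⟨P, hP⟩ := hX p hp
    exact P.not_dvd_index (hpn.trans (Int.natCast_dvd_natCast.1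
      (by simpa using hdvd ⟨_, hP⟩)))
  have h1 : (1 : ℤ) ∈ Ideal.span (Set.range fun H : X => ((H : Subgroup G).index : ℤ)) := by
    rw [htop]; exact Submodule.mem_top
  obtain ⟨c, hc⟩ := Finsupp.mem_ideal_span_range_iff_exists_finsupp.1 h1
  exact ⟨c, hc⟩

/-- Both sides are continuous in `w`, and on the dense image of `R(G)` this is the projection
formula with `b = 1`. -/
theorem completion_ind_completion_res (H : Subgroup G) (w : CompletedCharRing K G) :
    (ind (K := K) H).completion (continuous_ind H)
        ((res (K := K) H).toAddMonoidHom.completion (continuous_res H) w) =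
      (ind (K := K) H 1 : CompletedCharRing K G) * w := by
  refine UniformSpace.Completion.induction_on w (isClosed_eq (by fun_prop) (by fun_prop))
    fun a => ?_
  rw [AddMonoidHom.completion_coe, AddMonoidHom.completion_coe,
    ← UniformSpace.Completion.coe_mul, mul_comm (ind H 1) a, ← ind_res_mul, mul_one]
  rfl

end

end VirtualCharacter

end

/-- Let `G` be a finite group, `K` a field of characteristic zero, and `X` a family of subgroups
of `G` that contains a Sylow `p`-subgroup for each prime `p`. Induction from each subgroup is
continuous for the Grothendieck topologies, and the sum of the induced maps between the completed
character rings, over the members of `X`, is surjective. -/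
theorem mainTheorem5 {K : Type*} [Field K] [CharZero K] {G : Type*} [Group G] [Fintype G]
    [DecidableEq (Subgroup G)] :
    ∃ hind : ∀ H : Subgroup G, Continuous (VirtualCharacter.ind (K := K) H),
      ∀ X : Set (Subgroup G),
        (∀ p : ℕ, p.Prime → ∃ P : Sylow p G, (P : Subgroup G) ∈ X) →
        Function.Surjective
          (DirectSum.toAddMonoid fun H : X =>
            (VirtualCharacter.ind (K := K) (H : Subgroup G)).completion (hind H) :
            (DirectSum X fun H : X => VirtualCharacter.CompletedCharRing K (H : Subgroup G)) →+
              VirtualCharacter.CompletedCharRing K G) := by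
  refine ⟨VirtualCharacter.continuous_ind, fun X hX z => ?_⟩
  obtain ⟨c, hc⟩ := VirtualCharacter.exists_sum_mul_index_eq_one hX
  -- The degree of `ind_H 1` is the index of `H`, so `u` has degree `1` by the choice of `c`.
  set u : VirtualCharacter.CharRing K G :=
    ∑ H ∈ c.support, c H • VirtualCharacter.ind (K := K) (H : Subgroup G) 1 with hu
  have hx : 1 - u ∈ VirtualCharacter.augIdeal K G := by
    rw [VirtualCharacter.augIdeal, RingHom.mem_ker, map_sub, map_one, hu, map_sum, sub_eq_zero]
    simp only [zsmul_eq_mul, map_mul, map_intCast, VirtualCharacter.augmentation_ind_one]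
    rw [Finsupp.sum] at hc
    exact_mod_cast congrArg (Int.cast : ℤ → K) hc.symm
  obtain ⟨s, hs⟩ := VirtualCharacter.exists_mul_one_sub_eq_one hx
  rw [sub_sub_cancel] at hs
  -- With `s` the inverse of `u`, write `z = u * (s * z)`; the term of `u` at `H` times `s * z` is
  -- induced from the restriction of `s * z`.
  refine ⟨∑ H ∈ c.support, DirectSum.of
    (fun H : X => VirtualCharacter.CompletedCharRing K (H : Subgroup G)) H
    (c H • (VirtualCharacter.res (K := K) (H : Subgroup G)).toAddMonoidHom.completion
      (VirtualCharacter.continuous_res _) (s * z)), ?_⟩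
  rw [map_sum]
  simp only [DirectSum.toAddMonoid_of, map_zsmul, VirtualCharacter.completion_ind_completion_res]
  have hcoe : (u : VirtualCharacter.CompletedCharRing K G) =
      ∑ H ∈ c.support, c H • ((VirtualCharacter.ind (K := K) (H : Subgroup G) 1 :
        VirtualCharacter.CharRing K G) : VirtualCharacter.CompletedCharRing K G) := by
    change UniformSpace.Completion.toCompl u = _
    rw [hu, map_sum]
    simp only [map_zsmul]
    rfl
  simp only [← smul_mul_assoc]
  rw [← Finset.sum_mul, ← hcoe, ← mul_assoc, hs, one_mul]
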